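/- Let $\mathcal T^{24}=\mathbb R^{24}/\mathbb Z^{24}$ be the $24$-dimensional unit torus with the distance $d$ induced by the Euclidean distance and with its uniform probability measure $\mathrm{vol}$, and let $B(x,r)=\{y\in\mathcal T^{24}: d(x,y)\le r\}$ be the closed ball. There is an $n_0$ such that for every $n\ge n_0$ there exists a radius $r>0$ with the following property. If $x_1,\dots,x_n$ are independent uniformly random points of $\mathcal T^{24}$, then the event that $d(x_i,x_j)>r$ for all $i\ne j$ has positive probability, and \[ \mathbb E\Big[\mathrm{vol}\Big(\bigcup_{i=1}^n B(x_i,r)\Big)\,\Big|\, d(x_i,x_j)>r \text{ for all } i\ne j\Big] \;<\; \mathbb E\Big[\mathrm{vol}\Big(\bigcup_{i=1}^n B(x_i,r)\Big)\Big]. \] -/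

import Mathlib

open MeasureTheory Filter

noncomputable section

/-- The flat distance on the unit torus `(ℝ/ℤ)^d = ℝ^d/ℤ^d`: the norm on `UnitAddCircle` is the
distance to the nearest integer, so this is the quotient of the Euclidean distance, i.e. the
minimum of `|a - b|` over representatives `a, b ∈ ℝ^d` of `x, y`. (The metric that Mathlib puts on
`UnitAddTorus` by default is the sup metric, which is not used here.) -/
def torusDist {d : ℕ} (x y : UnitAddTorus (Fin d)) : ℝ :=
  Real.sqrt (∑ i, ‖x i - y i‖ ^ 2)

/-- The closed ball of radius `r` around `x` in the flat torus. -/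
def torusBall {d : ℕ} (x : UnitAddTorus (Fin d)) (r : ℝ) : Set (UnitAddTorus (Fin d)) :=
  {y | torusDist y x ≤ r}

/-- The volume of the union of the closed balls of radius `r` around the centers `x i`. -/
def unionVolume {d n : ℕ} (r : ℝ) (x : Fin n → UnitAddTorus (Fin d)) : ℝ :=
  (volume : Measure (UnitAddTorus (Fin d))).real (⋃ i, torusBall (x i) r)

/-- The event that the `n` centers are at pairwise distance greater than `r`. -/
def repulsionEvent (d n : ℕ) (r : ℝ) : Set (Fin n → UnitAddTorus (Fin d)) :=
  {x | ∀ i j, i ≠ j → r < torusDist (x i) (x j)}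

/-- The law of `n` independent uniformly distributed points of the unit torus: the `n`-fold product
of the Haar probability measure. -/
def uniformCenters (d n : ℕ) : Measure (Fin n → UnitAddTorus (Fin d)) :=
  Measure.pi fun _ => (volume : Measure (UnitAddTorus (Fin d)))

/-- The Haar measure on the unit circle has total mass one, so the law of the centers is a
probability measure. -/
theorem uniformCenters_univ (d n : ℕ) : uniformCenters d n Set.univ = 1 := by
  simp [uniformCenters, Measure.pi_univ, volume_pi]

theorem measurable_torusDist_comp {α : Type*} [MeasurableSpace α] {d : ℕ}
    {f g : α → UnitAddTorus (Fin d)} (hf : Measurable f) (hg : Measurable g) :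
    Measurable fun a => torusDist (f a) (g a) := by
  have h : ∀ i, Measurable fun a => ‖f a i - g a i‖ ^ 2 := fun i =>
    (((measurable_pi_apply i).comp hf).sub ((measurable_pi_apply i).comp hg)).norm.pow_const 2
  exact (Finset.measurable_fun_sum _ fun i _ => h i).sqrt

theorem measurableSet_repulsionEvent (d n : ℕ) (r : ℝ) :
    MeasurableSet (repulsionEvent d n r) := by
  have h : repulsionEvent d n r =
      ⋂ i, ⋂ j, ⋂ (_ : i ≠ j), {x | r < torusDist (x i) (x j)} := by
    ext x
    simp [repulsionEvent]
  rw [h]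
  refine MeasurableSet.iInter fun i => MeasurableSet.iInter fun j => MeasurableSet.iInter fun _ => ?_
  exact measurableSet_lt measurable_const
    (measurable_torusDist_comp (measurable_pi_apply i) (measurable_pi_apply j))

/-- The covered volume is a genuine random variable, so that the expectations below are not
junk values. -/
theorem measurable_unionVolume (d n : ℕ) (r : ℝ) :
    Measurable (unionVolume r : (Fin n → UnitAddTorus (Fin d)) → ℝ) := by
  have hs : MeasurableSet {q : (Fin n → UnitAddTorus (Fin d)) × UnitAddTorus (Fin d) |
      ∃ i, torusDist q.2 (q.1 i) ≤ r} := by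
    rw [Set.ofPred_exists]
    refine MeasurableSet.iUnion fun i => ?_
    exact measurableSet_le (measurable_torusDist_comp measurable_snd
      ((measurable_pi_apply i).comp measurable_fst)) measurable_const
  have hm := (measurable_measure_prodMk_left
    (ν := (volume : Measure (UnitAddTorus (Fin d)))) hs).ennreal_toReal
  convert hm using 2 with x
  simp only [unionVolume, Measure.real, torusBall]
  congr 2
  ext y
  simp

theorem integrable_unionVolume (d n : ℕ) (r : ℝ)
    (P : Measure (Fin n → UnitAddTorus (Fin d))) [IsFiniteMeasure P] :
    Integrable (unionVolume r) P := by
  refine Integrable.of_bound (measurable_unionVolume d n r).aestronglyMeasurable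
    ((volume : Measure (UnitAddTorus (Fin d))).real Set.univ) (Eventually.of_forall fun x => ?_)
  rw [unionVolume, Real.norm_of_nonneg measureReal_nonneg]
  exact measureReal_mono (Set.subset_univ _)

end

/-! Let Z_k be the probability that k uniform points are r-separated and v the volume of an r-ball.
A further point keeps the separation exactly when it falls in the uncovered set, so the conditional
mean uncovered volume is Z_{n+1}/Z_n, while for independent points it is (1-v)^n. The claim is
therefore that an insertion ratio satisfies Z_{n+1}/Z_n > (1-v)^n (`integral_cond_unionVolume_lt`).

Heuristic: write v = c r^d and let ρ = n r^d be the reduced density. If insertion never beat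
e^{-cρ}, the hard-sphere gas with chemical potential μ would have density at most about μ/c, hence
pressure at most about μ²/(2c). In dimension 24 a dense packing gives a linear lower bound S(μ - L)
for the pressure, with S ≈ 205700 and L ≈ 158. Since cS ≈ 397 exceeds 2L, this line crosses the
parabola (`parabola_lt_limitPressure`), a contradiction.

Making this rigorous takes three ingredients. The limiting pressure exists as r → 0 by subdividing
and magnifying the torus (`exists_tendsto_pressure`). It grows at most linearly, so pressure minus a
parabola has an interior maximum on a fine grid of chemical potentials; at that μ Chernoff bounds
confine the grand canonical particle number to a narrow density window (`eventually_insertion`).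
Finally, the ratios Z_{k+1}/Z_k fall by at most v when k increases by one
(`repulsionProb_succ_sq_le`), so a poor insertion ratio at the top of the window makes the grand
canonical weights decrease throughout it (`weight_antitone`). Then the window cannot carry the mass
either, which is impossible (`eventually_insertion_of_parabola`). -/

noncomputable section

open scoped ENNReal Nat Topology

/-! ### Hard-core gases on a general measure space: sub- and supermultiplicativity -/

section HardCore

variable {X Y : Type*} [MeasurableSpace X] [MeasurableSpace Y]

/-- The integral over `k` ordered points of `A` (with respect to `ν`) of the indicator that all
pairs are in the relation `R`. -/
def packInt (ν : Measure X) (R : X → X → Prop) : ℕ → Set X → ℝ≥0∞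
  | 0, _ => 1
  | k + 1, A => ∫⁻ x in A, packInt ν R k (A ∩ {y | R x y}) ∂ν

/-- The grand canonical partition function of the hard-core gas with intensity `ν` in `A`. -/
def partitionFn (ν : Measure X) (R : X → X → Prop) (A : Set X) : ℝ≥0∞ :=
  ∑' k, packInt ν R k A / (k ! : ℝ≥0∞)

theorem packInt_zero (ν : Measure X) (R : X → X → Prop) (A : Set X) : packInt ν R 0 A = 1 := rfl

theorem packInt_succ (ν : Measure X) (R : X → X → Prop) (k : ℕ) (A : Set X) :
    packInt ν R (k + 1) A = ∫⁻ x in A, packInt ν R k (A ∩ {y | R x y}) ∂ν := rfl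

theorem packInt_one (ν : Measure X) (R : X → X → Prop) (A : Set X) :
    packInt ν R 1 A = ν A := by
  simp [packInt_succ, packInt_zero]

theorem packInt_mono (ν : Measure X) (R : X → X → Prop) (k : ℕ) {A B : Set X} (h : A ⊆ B) :
    packInt ν R k A ≤ packInt ν R k B := by
  induction k generalizing A B with
  | zero => exact le_rfl
  | succ k ih =>
    rw [packInt_succ, packInt_succ]
    exact (lintegral_mono fun x => ih (Set.inter_subset_inter_left _ h)).trans
      (lintegral_mono_set h)

theorem packInt_le_pow (ν : Measure X) (R : X → X → Prop) (k : ℕ) (A : Set X) :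
    packInt ν R k A ≤ ν A ^ k := by
  induction k generalizing A with
  | zero => simp [packInt_zero]
  | succ k ih =>
    rw [packInt_succ]
    calc ∫⁻ x in A, packInt ν R k (A ∩ {y | R x y}) ∂ν ≤ ∫⁻ _ in A, ν A ^ k ∂ν :=
          lintegral_mono fun x => (packInt_mono ν R k Set.inter_subset_left).trans (ih A)
      _ = ν A ^ (k + 1) := by rw [setLIntegral_const, pow_succ]

theorem packInt_smul (ν : Measure X) (R : X → X → Prop) {c : ℝ≥0∞} (hc : c ≠ ∞) (k : ℕ)
    (A : Set X) : packInt (c • ν) R k A = c ^ k * packInt ν R k A := by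
  induction k generalizing A with
  | zero => simp [packInt_zero]
  | succ k ih =>
    simp_rw [packInt_succ, ih]
    rw [Measure.restrict_smul, lintegral_smul_measure,
      lintegral_const_mul' _ _ (ENNReal.pow_ne_top hc), smul_eq_mul, ← mul_assoc, pow_succ']

/-- The parameter space `P` becomes `P × X` in the induction, which is why it is generalized and
shares the universe of `X`. -/
theorem measurable_packInt.{u} {X P : Type u} [MeasurableSpace X] [MeasurableSpace P]
    (ν : Measure X) [SFinite ν]
    {R : X → X → Prop} (hR : MeasurableSet {p : X × X | R p.1 p.2}) (k : ℕ)
    {A : Set (P × X)} (hA : MeasurableSet A) :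
    Measurable fun p => packInt ν R k {x | (p, x) ∈ A} := by
  induction k generalizing P with
  | zero => exact measurable_const
  | succ k ih =>
    have hB : MeasurableSet {q : (P × X) × X | (q.1.1, q.2) ∈ A ∧ R q.1.2 q.2} :=
      (((measurable_fst.comp measurable_fst).prodMk measurable_snd) hA).inter
        (((measurable_snd.comp measurable_fst).prodMk measurable_snd) hR)
    have h : Measurable (A.indicator fun q : P × X =>
        packInt ν R k {x | (q, x) ∈ {q : (P × X) × X | (q.1.1, q.2) ∈ A ∧ R q.1.2 q.2}}) :=
      (ih hB).indicator hA
    convert h.lintegral_prod_right' (ν := ν) using 2 with p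
    rw [packInt_succ, ← lintegral_indicator (s := {x | (p, x) ∈ A}) (measurable_prodMk_left hA)]
    rfl

/-- Pascal's rule, sorted by whether the first of `k + 1` points belongs to the first or the second
family. -/
theorem sum_choose_mul_pascal (a b : ℕ → ℝ≥0∞) (k : ℕ) :
    ∑ j ∈ Finset.range (k + 1), (k.choose j : ℝ≥0∞) * (a (j + 1) * b (k - j)) +
      ∑ j ∈ Finset.range (k + 1), (k.choose j : ℝ≥0∞) * (a j * b (k - j + 1)) =
    ∑ j ∈ Finset.range (k + 2), ((k + 1).choose j : ℝ≥0∞) * (a j * b (k + 1 - j)) := by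
  rw [Finset.sum_range_succ' _ (k + 1)]
  simp_rw [Nat.choose_succ_succ, Nat.cast_add, add_mul, Finset.sum_add_distrib]
  simp only [Nat.add_sub_add_right, Nat.choose_zero_right, Nat.cast_one, one_mul, Nat.sub_zero,
    add_assoc]
  congr 1
  rw [Finset.sum_range_succ' _ k, Finset.sum_range_succ _ k]
  simp only [Nat.choose_succ_self, Nat.cast_zero, zero_mul, add_zero, Nat.choose_zero_right,
    Nat.cast_one, one_mul, Nat.sub_zero]
  congr 1
  refine Finset.sum_congr rfl fun j hj => ?_
  rw [show k - (j + 1) + 1 = k - j by have := Finset.mem_range.1 hj; omega]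

theorem packInt_ne_top (ν : Measure X) [IsFiniteMeasure ν] (R : X → X → Prop) (k : ℕ)
    (A : Set X) : packInt ν R k A ≠ ∞ :=
  ne_top_of_le_ne_top (ENNReal.pow_ne_top (measure_ne_top ν A)) (packInt_le_pow ν R k A)

/-- Each configuration splits into its parts in `A` and `B`; forgetting the constraints between the
two parts only enlarges the integral. Overlap of `A` and `B` is harmless for an upper bound. -/
theorem packInt_union_le (ν : Measure X) [IsFiniteMeasure ν] {R : X → X → Prop}
    (hR : MeasurableSet {p : X × X | R p.1 p.2}) (k : ℕ) {A B : Set X} (hA : MeasurableSet A)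
    (hB : MeasurableSet B) :
    packInt ν R k (A ∪ B) ≤ ∑ j ∈ Finset.range (k + 1),
      (k.choose j : ℝ≥0∞) * (packInt ν R j A * packInt ν R (k - j) B) := by
  induction k generalizing A B with
  | zero => simp [packInt_zero]
  | succ k ih =>
    have hRx : ∀ x, MeasurableSet {y | R x y} := fun x => measurable_prodMk_left hR
    have hm : ∀ (j : ℕ) {C : Set X}, MeasurableSet C →
        Measurable fun x => packInt ν R j (C ∩ {y | R x y}) := fun j C hC =>
      measurable_packInt (A := {p : X × X | p.2 ∈ C ∧ R p.1 p.2}) ν hR j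
        ((measurable_snd hC).inter hR)
    have hstep : ∀ x, packInt ν R k ((A ∪ B) ∩ {y | R x y}) ≤ ∑ j ∈ Finset.range (k + 1),
        (k.choose j : ℝ≥0∞) * (packInt ν R j (A ∩ {y | R x y}) *
          packInt ν R (k - j) (B ∩ {y | R x y})) := fun x => by
      rw [Set.union_inter_distrib_right]
      exact ih (hA.inter (hRx x)) (hB.inter (hRx x))
    rw [packInt_succ, ← sum_choose_mul_pascal (packInt ν R · A) (packInt ν R · B)]
    refine (lintegral_union_le _ A B).trans (add_le_add ?_ ?_)
    · calc ∫⁻ x in A, packInt ν R k ((A ∪ B) ∩ {y | R x y}) ∂ν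
          ≤ ∫⁻ x in A, ∑ j ∈ Finset.range (k + 1), (k.choose j : ℝ≥0∞) *
            (packInt ν R j (A ∩ {y | R x y}) * packInt ν R (k - j) B) ∂ν := by
            refine lintegral_mono fun x => (hstep x).trans (Finset.sum_le_sum fun j _ => ?_)
            gcongr
            exact packInt_mono _ _ _ Set.inter_subset_left
        _ = _ := by
            rw [lintegral_finsetSum _ fun j _ => ((hm j hA).mul_const _).const_mul _]
            refine Finset.sum_congr rfl fun j _ => ?_
            rw [lintegral_const_mul' _ _ (by simp),
              lintegral_mul_const' _ _ (packInt_ne_top ν R _ _), packInt_succ]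
    · calc ∫⁻ x in B, packInt ν R k ((A ∪ B) ∩ {y | R x y}) ∂ν
          ≤ ∫⁻ x in B, ∑ j ∈ Finset.range (k + 1), (k.choose j : ℝ≥0∞) *
            (packInt ν R j A * packInt ν R (k - j) (B ∩ {y | R x y})) ∂ν := by
            refine lintegral_mono fun x => (hstep x).trans (Finset.sum_le_sum fun j _ => ?_)
            gcongr
            exact packInt_mono _ _ _ Set.inter_subset_left
        _ = _ := by
            rw [lintegral_finsetSum _ fun j _ => ((hm _ hB).const_mul _).const_mul _]
            refine Finset.sum_congr rfl fun j _ => ?_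
            rw [lintegral_const_mul' _ _ (by simp),
              lintegral_const_mul' _ _ (packInt_ne_top ν R _ _), packInt_succ]

/-- When every cross pair is compatible no constraint is lost in the splitting, and disjointness
prevents double counting. -/
theorem le_packInt_union (ν : Measure X) [IsFiniteMeasure ν] {R : X → X → Prop}
    (hR : MeasurableSet {p : X × X | R p.1 p.2}) (k : ℕ) {A B : Set X} (hA : MeasurableSet A)
    (hB : MeasurableSet B) (hd : Disjoint A B) (hAB : ∀ x ∈ A, ∀ y ∈ B, R x y)
    (hBA : ∀ x ∈ B, ∀ y ∈ A, R x y) :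
    ∑ j ∈ Finset.range (k + 1),
      (k.choose j : ℝ≥0∞) * (packInt ν R j A * packInt ν R (k - j) B) ≤
      packInt ν R k (A ∪ B) := by
  induction k generalizing A B with
  | zero => simp [packInt_zero]
  | succ k ih =>
    have hRx : ∀ x, MeasurableSet {y | R x y} := fun x => measurable_prodMk_left hR
    have hm : ∀ (j : ℕ) {C : Set X}, MeasurableSet C →
        Measurable fun x => packInt ν R j (C ∩ {y | R x y}) := fun j C hC =>
      measurable_packInt (A := {p : X × X | p.2 ∈ C ∧ R p.1 p.2}) ν hR j
        ((measurable_snd hC).inter hR)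
    have hstep : ∀ x, ∑ j ∈ Finset.range (k + 1),
        (k.choose j : ℝ≥0∞) * (packInt ν R j (A ∩ {y | R x y}) *
          packInt ν R (k - j) (B ∩ {y | R x y})) ≤ packInt ν R k ((A ∪ B) ∩ {y | R x y}) :=
      fun x => by
        rw [Set.union_inter_distrib_right]
        exact ih (hA.inter (hRx x)) (hB.inter (hRx x))
          (hd.mono Set.inter_subset_left Set.inter_subset_left)
          (fun y hy z hz => hAB y hy.1 z hz.1) (fun y hy z hz => hBA y hy.1 z hz.1)
    rw [packInt_succ, ← sum_choose_mul_pascal (packInt ν R · A) (packInt ν R · B),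
      lintegral_union hB hd]
    refine add_le_add ?_ ?_
    · calc _ = ∫⁻ x in A, ∑ j ∈ Finset.range (k + 1), (k.choose j : ℝ≥0∞) *
            (packInt ν R j (A ∩ {y | R x y}) * packInt ν R (k - j) B) ∂ν := by
            rw [lintegral_finsetSum _ fun j _ => ((hm j hA).mul_const _).const_mul _]
            refine Finset.sum_congr rfl fun j _ => ?_
            rw [lintegral_const_mul' _ _ (by simp),
              lintegral_mul_const' _ _ (packInt_ne_top ν R _ _), packInt_succ]
        _ ≤ _ := by
            refine setLIntegral_mono' hA fun x hx => le_trans (le_of_eq ?_) (hstep x)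
            rw [Set.inter_eq_left.2 (show B ⊆ {y | R x y} from fun y hy => hAB x hx y hy)]
    · calc _ = ∫⁻ x in B, ∑ j ∈ Finset.range (k + 1), (k.choose j : ℝ≥0∞) *
            (packInt ν R j A * packInt ν R (k - j) (B ∩ {y | R x y})) ∂ν := by
            rw [lintegral_finsetSum _ fun j _ => ((hm _ hB).const_mul _).const_mul _]
            refine Finset.sum_congr rfl fun j _ => ?_
            rw [lintegral_const_mul' _ _ (by simp),
              lintegral_const_mul' _ _ (packInt_ne_top ν R _ _), packInt_succ]
        _ ≤ _ := by
            refine setLIntegral_mono' hB fun x hx => le_trans (le_of_eq ?_) (hstep x)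
            rw [Set.inter_eq_left.2 (show A ⊆ {y | R x y} from fun y hy => hBA x hx y hy)]

/-- A compatible configuration is carried point by point to a compatible one, and the image
intensity is dominated by `ν'`. This is how a small cube is compared with the whole torus. -/
theorem packInt_le_of_map (ν : Measure X) (ν' : Measure Y) [SFinite ν'] {R : X → X → Prop}
    {R' : Y → Y → Prop} (hR : MeasurableSet {p : X × X | R p.1 p.2})
    (hR' : MeasurableSet {p : Y × Y | R' p.1 p.2}) {f : X → Y}
    (hf : Measurable f) (k : ℕ) {A : Set X} {B : Set Y} (hA : MeasurableSet A)
    (hB : MeasurableSet B) (hAB : Set.MapsTo f A B)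
    (hRR : ∀ x ∈ A, ∀ y ∈ A, R x y → R' (f x) (f y)) (hν : (ν.restrict A).map f ≤ ν') :
    packInt ν R k A ≤ packInt ν' R' k B := by
  induction k generalizing A B with
  | zero => exact le_rfl
  | succ k ih =>
    have hRx : ∀ x, MeasurableSet {y | R x y} := fun x => measurable_prodMk_left hR
    have hRx' : ∀ x, MeasurableSet {y | R' x y} := fun x => measurable_prodMk_left hR'
    have hm : Measurable fun x => packInt ν' R' k (B ∩ {y | R' x y}) :=
      measurable_packInt (A := {p : Y × Y | p.2 ∈ B ∧ R' p.1 p.2}) ν' hR' k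
        ((measurable_snd hB).inter hR')
    rw [packInt_succ, packInt_succ, ← lintegral_indicator hB]
    calc ∫⁻ x in A, packInt ν R k (A ∩ {y | R x y}) ∂ν
        ≤ ∫⁻ x in A, B.indicator (fun x => packInt ν' R' k (B ∩ {y | R' x y})) (f x) ∂ν := by
          refine setLIntegral_mono' hA fun x hx => ?_
          rw [Set.indicator_of_mem (hAB hx)]
          refine ih (hA.inter (hRx x)) (hB.inter (hRx' _))
            (fun y hy => ⟨hAB hy.1, hRR x hx y hy.1 hy.2⟩)
            (fun y hy z hz => hRR y hy.1 z hz.1) (le_trans ?_ hν)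
          exact Measure.map_mono (Measure.restrict_mono Set.inter_subset_left le_rfl) hf
      _ = ∫⁻ y, B.indicator (fun x => packInt ν' R' k (B ∩ {y | R' x y})) y
            ∂((ν.restrict A).map f) := (lintegral_map (hm.indicator hB) hf).symm
      _ ≤ _ := lintegral_mono' hν le_rfl

/-- Symmetry of `R` is what lets the recursion, which tests each new point in one direction only,
recover all ordered pairs. -/
theorem packInt_eq_pi (ν : Measure X) [SigmaFinite ν] {R : X → X → Prop}
    (hR : MeasurableSet {p : X × X | R p.1 p.2}) (hs : ∀ x y, R x y → R y x) (k : ℕ)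
    {A : Set X} (hA : MeasurableSet A) :
    packInt ν R k A = Measure.pi (fun _ : Fin k => ν)
      {x | (∀ i, x i ∈ A) ∧ ∀ i j, i ≠ j → R (x i) (x j)} := by
  have hS : ∀ (k : ℕ) {A : Set X}, MeasurableSet A → MeasurableSet
      {x : Fin k → X | (∀ i, x i ∈ A) ∧ ∀ i j, i ≠ j → R (x i) (x j)} := by
    intro k A hA
    have h : {x : Fin k → X | (∀ i, x i ∈ A) ∧ ∀ i j, i ≠ j → R (x i) (x j)} =
        (⋂ i, {x | x i ∈ A}) ∩ ⋂ i, ⋂ j, ⋂ (_ : i ≠ j), {x | R (x i) (x j)} := by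
      ext x
      simp
    rw [h]
    exact (MeasurableSet.iInter fun i => measurable_pi_apply i hA).inter
      (MeasurableSet.iInter fun i => MeasurableSet.iInter fun j => MeasurableSet.iInter fun _ =>
        measurableSet_preimage (f := fun x : Fin k → X => (x i, x j))
          ((measurable_pi_apply i).prodMk (measurable_pi_apply j)) hR)
  induction k generalizing A with
  | zero => simp [packInt_zero]
  | succ k ih =>
    have hRx : ∀ x, MeasurableSet {y | R x y} := fun x => measurable_prodMk_left hR
    have hmp := measurePreserving_piFinSuccAbove (fun _ : Fin (k + 1) => ν) 0
    rw [packInt_succ, ← hmp.symm.measure_preimage (hS _ hA).nullMeasurableSet,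
      Measure.prod_apply (hmp.symm.measurable (hS _ hA)), ← lintegral_indicator hA]
    refine lintegral_congr fun x => ?_
    by_cases hx : x ∈ A
    · rw [Set.indicator_of_mem hx, ih (hA.inter (hRx x))]
      congr 1
      ext t
      simp only [Set.mem_preimage, MeasurableEquiv.piFinSuccAbove_symm_apply, Set.mem_ofPred_eq,
        Fin.insertNthEquiv_zero, Fin.consEquiv_apply, Fin.forall_fin_succ, Fin.cons_zero,
        Fin.cons_succ, Set.mem_inter_iff]
      constructor
      · rintro ⟨h1, h2⟩
        refine ⟨⟨hx, fun i => (h1 i).1⟩, ⟨fun h => absurd rfl h, fun i _ => (h1 i).2⟩, fun i =>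
          ⟨fun _ => hs _ _ (h1 i).2, fun j hij => h2 i j fun h => hij (h ▸ rfl)⟩⟩
      · rintro ⟨⟨_, h1⟩, ⟨_, h2⟩, h3⟩
        exact ⟨fun i => ⟨h1 i, h2 i (Fin.succ_ne_zero i).symm⟩, fun i j hij =>
          (h3 i).2 j fun h => hij (Fin.succ_injective _ h)⟩
    · rw [Set.indicator_of_notMem hx, eq_comm]
      convert measure_empty (μ := Measure.pi fun _ : Fin k => ν)
      ext t
      simp only [Set.mem_preimage, Set.mem_ofPred_eq, Set.mem_empty_iff_false, iff_false]
      intro h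
      exact hx (by simpa using h.1 0)

theorem one_le_partitionFn (ν : Measure X) (R : X → X → Prop) (A : Set X) :
    1 ≤ partitionFn ν R A := by
  refine le_trans ?_ (ENNReal.le_tsum 0)
  simp [packInt_zero]

theorem one_add_le_partitionFn (ν : Measure X) (R : X → X → Prop) (A : Set X) :
    1 + ν A ≤ partitionFn ν R A := by
  refine le_trans ?_ (ENNReal.sum_le_tsum (Finset.range 2))
  simp [Finset.sum_range_succ, packInt_zero, packInt_one]

/-- Cauchy product of exponential generating functions; it turns the binomial estimates for
`packInt` into product estimates for `partitionFn`. -/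
theorem tsum_div_factorial_mul (a b : ℕ → ℝ≥0∞) :
    (∑' k, a k / (k ! : ℝ≥0∞)) * (∑' k, b k / (k ! : ℝ≥0∞)) =
      ∑' k, (∑ j ∈ Finset.range (k + 1), (k.choose j : ℝ≥0∞) * (a j * b (k - j))) /
        (k ! : ℝ≥0∞) := by
  have h0 : ∀ k : ℕ, (k ! : ℝ≥0∞) ≠ 0 := fun k => by exact_mod_cast k.factorial_ne_zero
  have ht : ∀ k : ℕ, (k ! : ℝ≥0∞) ≠ ∞ := fun k => ENNReal.natCast_ne_top _
  rw [← ENNReal.tsum_mul_right]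
  simp_rw [← ENNReal.tsum_mul_left]
  rw [← ENNReal.tsum_prod (f := fun i j => a i / (i ! : ℝ≥0∞) * (b j / (j ! : ℝ≥0∞))),
    ← Finset.HasAntidiagonal.sigmaAntidiagonalEquivProd.tsum_eq, ENNReal.tsum_sigma']
  refine tsum_congr fun k => ?_
  rw [tsum_fintype, Finset.univ_eq_attach]
  refine (Finset.sum_attach (Finset.HasAntidiagonal.antidiagonal k)
    fun p => a p.1 / (p.1 ! : ℝ≥0∞) * (b p.2 / (p.2 ! : ℝ≥0∞))).trans ?_
  rw [Finset.Nat.sum_antidiagonal_eq_sum_range_succ_mk, div_eq_mul_inv, Finset.sum_mul]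
  refine Finset.sum_congr rfl fun j hj => ?_
  have hjk : j ≤ k := by have := Finset.mem_range.1 hj; omega
  have hc : (k ! : ℝ≥0∞) = k.choose j * j ! * (k - j)! := by
    exact_mod_cast (Nat.choose_mul_factorial_mul_factorial hjk).symm
  have hc0 : (k.choose j : ℝ≥0∞) ≠ 0 := by exact_mod_cast (Nat.choose_pos hjk).ne'
  have hct : (k.choose j : ℝ≥0∞) ≠ ∞ := ENNReal.natCast_ne_top _
  rw [hc, ENNReal.mul_inv (Or.inr (ht _)) (Or.inr (h0 _)),
    ENNReal.mul_inv (Or.inl hc0) (Or.inl hct), div_eq_mul_inv, div_eq_mul_inv]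
  calc _ = (k.choose j * (k.choose j : ℝ≥0∞)⁻¹) *
        (a j * (j ! : ℝ≥0∞)⁻¹ * (b (k - j) * ((k - j)! : ℝ≥0∞)⁻¹)) := by
        rw [ENNReal.mul_inv_cancel hc0 hct, one_mul]
    _ = _ := by ring

theorem partitionFn_mono (ν : Measure X) (R : X → X → Prop) {A B : Set X} (h : A ⊆ B) :
    partitionFn ν R A ≤ partitionFn ν R B :=
  ENNReal.tsum_le_tsum fun k => ENNReal.div_le_div_right (packInt_mono ν R k h) _

theorem partitionFn_union_le (ν : Measure X) [IsFiniteMeasure ν] {R : X → X → Prop}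
    (hR : MeasurableSet {p : X × X | R p.1 p.2}) {A B : Set X} (hA : MeasurableSet A)
    (hB : MeasurableSet B) :
    partitionFn ν R (A ∪ B) ≤ partitionFn ν R A * partitionFn ν R B := by
  rw [partitionFn, partitionFn, partitionFn, tsum_div_factorial_mul]
  exact ENNReal.tsum_le_tsum fun k => ENNReal.div_le_div_right (packInt_union_le ν hR k hA hB) _

theorem le_partitionFn_union (ν : Measure X) [IsFiniteMeasure ν] {R : X → X → Prop}
    (hR : MeasurableSet {p : X × X | R p.1 p.2}) {A B : Set X} (hA : MeasurableSet A)
    (hB : MeasurableSet B) (hd : Disjoint A B) (hAB : ∀ x ∈ A, ∀ y ∈ B, R x y)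
    (hBA : ∀ x ∈ B, ∀ y ∈ A, R x y) :
    partitionFn ν R A * partitionFn ν R B ≤ partitionFn ν R (A ∪ B) := by
  rw [partitionFn, partitionFn, partitionFn, tsum_div_factorial_mul]
  exact ENNReal.tsum_le_tsum fun k =>
    ENNReal.div_le_div_right (le_packInt_union ν hR k hA hB hd hAB hBA) _

theorem partitionFn_empty (ν : Measure X) (R : X → X → Prop) : partitionFn ν R ∅ = 1 := by
  rw [partitionFn, tsum_eq_single 0]
  · simp [packInt_zero]
  · intro k hk
    obtain ⟨k, rfl⟩ := Nat.exists_eq_succ_of_ne_zero hk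
    simp [packInt_succ]

theorem partitionFn_biUnion_le (ν : Measure X) [IsFiniteMeasure ν] {R : X → X → Prop}
    (hR : MeasurableSet {p : X × X | R p.1 p.2}) {ι : Type*} (s : Finset ι) {A : ι → Set X}
    (hA : ∀ i, MeasurableSet (A i)) :
    partitionFn ν R (⋃ i ∈ s, A i) ≤ ∏ i ∈ s, partitionFn ν R (A i) := by
  classical
  induction s using Finset.induction_on with
  | empty => simp [partitionFn_empty]
  | insert a s ha ih =>
    rw [Finset.set_biUnion_insert, Finset.prod_insert ha]
    refine (partitionFn_union_le ν hR (hA a)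
      (Finset.measurableSet_biUnion s fun i _ => hA i)).trans ?_
    gcongr

/-- Restrict to configurations with at most one point in each cell: mutually compatible cells then
contribute independently. -/
theorem prod_one_add_le_partitionFn (ν : Measure X) [IsFiniteMeasure ν] {R : X → X → Prop}
    (hR : MeasurableSet {p : X × X | R p.1 p.2}) {ι : Type*} (s : Finset ι) {A : ι → Set X}
    (hA : ∀ i, MeasurableSet (A i)) (hd : ∀ i j, i ≠ j → Disjoint (A i) (A j))
    (hAR : ∀ i j, i ≠ j → ∀ x ∈ A i, ∀ y ∈ A j, R x y) :
    ∏ i ∈ s, (1 + ν (A i)) ≤ partitionFn ν R (⋃ i ∈ s, A i) := by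
  classical
  induction s using Finset.induction_on with
  | empty => simp [partitionFn_empty]
  | insert a s ha ih =>
    rw [Finset.set_biUnion_insert, Finset.prod_insert ha]
    have hne : ∀ i ∈ s, a ≠ i := fun i hi h => ha (h ▸ hi)
    refine le_trans ?_ (le_partitionFn_union ν hR (hA a)
      (Finset.measurableSet_biUnion s fun i _ => hA i) ?_ ?_ ?_)
    · gcongr
      exact one_add_le_partitionFn _ _ _
    · simp only [Set.disjoint_iUnion_right]
      exact fun i hi => hd a i (hne i hi)
    · intro x hx y hy
      simp only [Set.mem_iUnion] at hy
      obtain ⟨i, hi, hy⟩ := hy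
      exact hAR a i (hne i hi) x hx y hy
    · intro x hx y hy
      simp only [Set.mem_iUnion] at hx
      obtain ⟨i, hi, hx⟩ := hx
      exact hAR i a (hne i hi).symm x hx y hy

end HardCore

/-! ### Insertion probabilities and their comparison with independent points -/

section Canonical

variable {d : ℕ}

instance isProbabilityMeasure_uniformCenters (d n : ℕ) :
    IsProbabilityMeasure (uniformCenters d n) := ⟨uniformCenters_univ d n⟩

instance isProbabilityMeasure_volume_unitAddTorus (d : ℕ) :
    IsProbabilityMeasure (volume : Measure (UnitAddTorus (Fin d))) :=
  ⟨by simp [volume_pi, Measure.pi_univ]⟩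

theorem torusDist_comm (x y : UnitAddTorus (Fin d)) : torusDist x y = torusDist y x := by
  simp only [torusDist, norm_sub_rev]

theorem torusDist_sub_zero (x y : UnitAddTorus (Fin d)) :
    torusDist (x - y) 0 = torusDist x y := by
  simp [torusDist]

theorem measurableSet_torusDist_gt (d : ℕ) (r : ℝ) : MeasurableSet
    {p : UnitAddTorus (Fin d) × UnitAddTorus (Fin d) | r < torusDist p.1 p.2} :=
  measurableSet_lt measurable_const (measurable_torusDist_comp measurable_fst measurable_snd)

theorem measurableSet_torusBall (x : UnitAddTorus (Fin d)) (r : ℝ) :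
    MeasurableSet (torusBall x r) :=
  measurableSet_le (measurable_torusDist_comp measurable_id measurable_const) measurable_const

/-- The probability that `n` uniform centers are at pairwise distance greater than `r`. -/
def repulsionProb (d n : ℕ) (r : ℝ) : ℝ := (uniformCenters d n).real (repulsionEvent d n r)

theorem repulsionProb_nonneg (d n : ℕ) (r : ℝ) : 0 ≤ repulsionProb d n r := measureReal_nonneg

theorem repulsionProb_le_one (d n : ℕ) (r : ℝ) : repulsionProb d n r ≤ 1 := measureReal_le_one

/-- The volume of a ball of radius `r` in the torus. -/
def ballVolume (d : ℕ) (r : ℝ) : ℝ :=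
  (volume : Measure (UnitAddTorus (Fin d))).real (torusBall 0 r)

theorem volume_real_torusBall (x : UnitAddTorus (Fin d)) (r : ℝ) :
    (volume : Measure (UnitAddTorus (Fin d))).real (torusBall x r) = ballVolume d r := by
  have h : torusBall x r = (fun y => y + -x) ⁻¹' torusBall 0 r := by
    ext y
    simp only [torusBall, Set.mem_preimage, Set.mem_ofPred_eq, ← sub_eq_add_neg,
      torusDist_sub_zero]
  rw [ballVolume, h, measureReal_def, measureReal_def, measure_preimage_add_right]

theorem volume_real_uncovered {n : ℕ} (r : ℝ) (x : Fin n → UnitAddTorus (Fin d)) :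
    (volume : Measure (UnitAddTorus (Fin d))).real {y | ∀ i, r < torusDist y (x i)} =
      1 - unionVolume r x := by
  have h : {y | ∀ i, r < torusDist y (x i)} = (⋃ i, torusBall (x i) r)ᶜ := by
    ext y
    simp [torusBall]
  rw [h, probReal_compl_eq_one_sub (MeasurableSet.iUnion fun i => measurableSet_torusBall _ _),
    unionVolume]

theorem unionVolume_le_one {n : ℕ} (r : ℝ) (x : Fin n → UnitAddTorus (Fin d)) :
    unionVolume r x ≤ 1 := measureReal_le_one

theorem unionVolume_nonneg {n : ℕ} (r : ℝ) (x : Fin n → UnitAddTorus (Fin d)) :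
    0 ≤ unionVolume r x := measureReal_nonneg

theorem unionVolume_le_tail {n : ℕ} (r : ℝ) (x : Fin (n + 1) → UnitAddTorus (Fin d)) :
    unionVolume r x ≤ unionVolume r (Fin.tail x) + ballVolume d r := by
  have h : (⋃ i, torusBall (x i) r) = (⋃ i, torusBall (Fin.tail x i) r) ∪ torusBall (x 0) r := by
    ext y
    simp only [Set.mem_iUnion, Set.mem_union, Fin.exists_fin_succ, Fin.tail]
    tauto
  rw [unionVolume, h]
  refine (measureReal_union_le _ _).trans ?_
  rw [volume_real_torusBall, unionVolume]

/-- Integrate out the first point by Fubini: given the others, it must lie in the set they leave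
uncovered. -/
theorem setIntegral_repulsionEvent_tail (n : ℕ) (r : ℝ)
    {f : (Fin n → UnitAddTorus (Fin d)) → ℝ} (hf : Measurable f) {C : ℝ} (hC : ∀ x, ‖f x‖ ≤ C) :
    ∫ x in repulsionEvent d (n + 1) r, f (Fin.tail x) ∂uniformCenters d (n + 1) =
      ∫ x in repulsionEvent d n r, f x * (1 - unionVolume r x) ∂uniformCenters d n := by
  let T := UnitAddTorus (Fin d)
  have hmp := measurePreserving_piFinSuccAbove
    (fun _ : Fin (n + 1) => (volume : Measure T)) 0
  let S : Set (T × (Fin n → T)) :=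
    {p | p.2 ∈ repulsionEvent d n r ∧ ∀ i, r < torusDist p.1 (p.2 i)}
  have hS : MeasurableSet S := by
    have h : S = {p | p.2 ∈ repulsionEvent d n r} ∩
        ⋂ i, {p | r < torusDist p.1 (p.2 i)} := by
      ext p
      simp [S]
    rw [h]
    exact (measurable_snd (measurableSet_repulsionEvent d n r)).inter
      (MeasurableSet.iInter fun i => measurableSet_lt measurable_const
        (measurable_torusDist_comp measurable_fst
          ((measurable_pi_apply i).comp measurable_snd)))
  have h1 : ∀ x : Fin (n + 1) → T, (repulsionEvent d (n + 1) r).indicator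
      (fun x => f (Fin.tail x)) x =
      (S.indicator fun p => f p.2) (MeasurableEquiv.piFinSuccAbove (fun _ => T) 0 x) := by
    intro x
    have hx : x ∈ repulsionEvent d (n + 1) r ↔
        MeasurableEquiv.piFinSuccAbove (fun _ => T) 0 x ∈ S := by
      simp only [repulsionEvent, S, Set.mem_ofPred_eq, Fin.forall_fin_succ,
        MeasurableEquiv.piFinSuccAbove_apply, Fin.insertNthEquiv_zero, Fin.consEquiv_symm_apply,
        Fin.tail]
      constructor
      · rintro ⟨⟨_, h⟩, h'⟩
        exact ⟨fun i j hij => (h' i).2 j fun h => hij (Fin.succ_injective _ h), fun i =>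
          h i (Fin.succ_ne_zero i).symm⟩
      · rintro ⟨h, h'⟩
        exact ⟨⟨fun h => absurd rfl h, fun i _ => h' i⟩, fun i =>
          ⟨fun _ => torusDist_comm (x 0) (x i.succ) ▸ h' i,
            fun j hij => h i j fun h => hij (h ▸ rfl)⟩⟩
    by_cases h : x ∈ repulsionEvent d (n + 1) r
    · rw [Set.indicator_of_mem h, Set.indicator_of_mem (hx.1 h)]
      simp
    · rw [Set.indicator_of_notMem h, Set.indicator_of_notMem (mt hx.2 h)]
  rw [← integral_indicator (measurableSet_repulsionEvent _ _ _), integral_congr_ae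
    (Eventually.of_forall h1), ← integral_indicator (measurableSet_repulsionEvent _ _ _)]
  unfold uniformCenters
  rw [hmp.integral_comp', integral_prod_symm]
  · refine integral_congr_ae (Eventually.of_forall fun t => ?_)
    by_cases ht : t ∈ repulsionEvent d n r
    · have h2 : ∀ a : T, S.indicator (fun p => f p.2) (a, t) =
          {a | ∀ i, r < torusDist a (t i)}.indicator (fun _ => f t) a := by
        intro a
        by_cases ha : a ∈ {a | ∀ i, r < torusDist a (t i)}
        · rw [Set.indicator_of_mem (show (a, t) ∈ S from ⟨ht, ha⟩), Set.indicator_of_mem ha]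
        · rw [Set.indicator_of_notMem (fun h => ha h.2), Set.indicator_of_notMem ha]
      simp only [h2, Set.indicator_of_mem ht]
      rw [integral_indicator, setIntegral_const, volume_real_uncovered, smul_eq_mul, mul_comm]
      have h3 : {a : T | ∀ i, r < torusDist a (t i)} = ⋂ i, {a | r < torusDist a (t i)} := by
        ext a
        rw [Set.mem_iInter]
        rfl
      rw [h3]
      exact MeasurableSet.iInter fun i => measurableSet_lt measurable_const
        (measurable_torusDist_comp measurable_id measurable_const)
    · have h2 : ∀ a : T, S.indicator (fun p => f p.2) (a, t) = 0 := fun a =>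
        Set.indicator_of_notMem (fun h => ht h.1) _
      simp only [h2, Set.indicator_of_notMem ht, integral_zero]
  · refine Integrable.of_bound ((hf.comp measurable_snd).indicator hS).aestronglyMeasurable C
      (Eventually.of_forall fun p => ?_)
    exact (norm_indicator_le_norm_self _ _).trans (hC _)

theorem repulsionProb_succ (n : ℕ) (r : ℝ) : repulsionProb d (n + 1) r =
    ∫ x in repulsionEvent d n r, (1 - unionVolume r x) ∂uniformCenters d n := by
  have h := setIntegral_repulsionEvent_tail (d := d) n r (f := fun _ => 1) measurable_const
    (C := 1) (by simp)
  simpa [repulsionProb] using h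

theorem integrable_uncovered_mul (d n : ℕ) (r a b : ℝ) (μ : Measure (Fin n → UnitAddTorus (Fin d)))
    [IsFiniteMeasure μ] :
    Integrable (fun x => (1 - unionVolume r x - a) * (1 - unionVolume r x - b)) μ := by
  refine Integrable.of_bound (C := (2 + |a|) * (2 + |b|)) ?_ (Eventually.of_forall fun x => ?_)
  · exact (((measurable_const.sub (measurable_unionVolume d n r)).sub_const a).mul
      ((measurable_const.sub (measurable_unionVolume d n r)).sub_const b)).aestronglyMeasurable
  · have h0 := unionVolume_nonneg r x
    have h1 := unionVolume_le_one r x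
    rw [norm_mul, Real.norm_eq_abs, Real.norm_eq_abs]
    have h : ∀ c : ℝ, |1 - unionVolume r x - c| ≤ 2 + |c| := fun c => by
      refine (abs_sub _ _).trans ?_
      rw [abs_of_nonneg (by linarith)]
      linarith
    exact mul_le_mul (h a) (h b) (abs_nonneg _) (by positivity)

/-- Inserting two further points: `Z_{k+1}² ≤ Z_k (Z_{k+2} + v Z_{k+1})`. -/
theorem repulsionProb_succ_sq_le (n : ℕ) (r : ℝ) :
    repulsionProb d (n + 1) r ^ 2 ≤ repulsionProb d n r *
      (repulsionProb d (n + 2) r + ballVolume d r * repulsionProb d (n + 1) r) := by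
  set v := ballVolume d r
  set Z := repulsionProb d n r with hZ
  set Z1 := repulsionProb d (n + 1) r with hZ1
  set μ := (uniformCenters d n).restrict (repulsionEvent d n r) with hμ
  have hU : Integrable (fun x => 1 - unionVolume r x) μ :=
    (integrable_const 1).sub (integrable_unionVolume d n r μ)
  have hI1 : ∫ x, (1 - unionVolume r x) ∂μ = Z1 := (repulsionProb_succ n r).symm
  have hI0 : ∫ _, (1 : ℝ) ∂μ = Z := by simp [hZ, repulsionProb, hμ]
  -- Insert two points in succession: the first lowers the uncovered volume by at most `v` before
  -- the second arrives.
  have h1 : ∫ x, (1 - unionVolume r x - v) * (1 - unionVolume r x - 0) ∂μ ≤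
      repulsionProb d (n + 2) r := by
    have h := setIntegral_repulsionEvent_tail (d := d) n r (f := fun x => 1 - unionVolume r x - v)
      ((measurable_const.sub (measurable_unionVolume d n r)).sub_const v) (C := 2 + |v|)
      (fun x => by
        have h0 := unionVolume_nonneg r x
        have h1 := unionVolume_le_one r x
        refine (norm_sub_le _ _).trans ?_
        rw [Real.norm_eq_abs, Real.norm_eq_abs, abs_of_nonneg (by linarith)]
        linarith)
    simp only [sub_zero]
    rw [← h, repulsionProb_succ]
    refine integral_mono ?_ ?_ fun x => ?_
    · refine Integrable.of_bound (C := 2 + |v|) ?_ (Eventually.of_forall fun x => ?_)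
      · have ht : Measurable fun x : Fin (n + 1) → UnitAddTorus (Fin d) => Fin.tail x :=
          measurable_pi_lambda _ fun i => measurable_pi_apply _
        exact (((measurable_const.sub (measurable_unionVolume d n r)).sub_const v).comp
          ht).aestronglyMeasurable
      · have h0 := unionVolume_nonneg r (Fin.tail x)
        have h1 := unionVolume_le_one r (Fin.tail x)
        refine (norm_sub_le _ _).trans ?_
        rw [Real.norm_eq_abs, Real.norm_eq_abs, abs_of_nonneg (by linarith)]
        linarith
    · exact (integrable_const 1).sub (integrable_unionVolume d (n + 1) r _)
    · have := unionVolume_le_tail r x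
      simp only
      linarith
  have h2 : ∫ x, (1 - unionVolume r x - v) * (1 - unionVolume r x - 0) ∂μ =
      ∫ x, (1 - unionVolume r x) ^ 2 ∂μ - v * Z1 := by
    rw [← hI1, ← integral_const_mul, ← integral_sub _ (hU.const_mul v)]
    · exact integral_congr_ae (Eventually.of_forall fun x => by ring)
    · convert integrable_uncovered_mul d n r 0 0 μ using 2
      ring
  -- Cauchy–Schwarz in the form ∫(U - a)² ≥ 0, to be used with `a` equal to the mean `Z1 / Z` of the
  -- uncovered volume U.
  have h3 : ∀ a : ℝ, 2 * a * Z1 - a ^ 2 * Z ≤ ∫ x, (1 - unionVolume r x) ^ 2 ∂μ := by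
    intro a
    have h := integral_nonneg (μ := μ)
      (f := fun x => (1 - unionVolume r x - a) * (1 - unionVolume r x - a))
      fun x => mul_self_nonneg _
    have h4 : ∫ x, (1 - unionVolume r x - a) * (1 - unionVolume r x - a) ∂μ =
        ∫ x, (1 - unionVolume r x) ^ 2 ∂μ - (2 * a * Z1 - a ^ 2 * Z) := by
      rw [← hI1, ← hI0, ← integral_const_mul, ← integral_const_mul,
        ← integral_sub (hU.const_mul _) ((integrable_const (1 : ℝ)).const_mul _)]
      rw [← integral_sub _ (by
        exact (hU.const_mul _).sub ((integrable_const (1 : ℝ)).const_mul _))]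
      · exact integral_congr_ae (Eventually.of_forall fun x => by ring)
      · convert integrable_uncovered_mul d n r 0 0 μ using 2
        ring
    linarith
  have hZ0 : 0 ≤ Z := repulsionProb_nonneg _ _ _
  rcases hZ0.eq_or_lt with h0 | h0
  · have : Z1 = 0 := by
      have h5 : μ = 0 := by
        rw [hμ, Measure.restrict_eq_zero, ← measureReal_eq_zero_iff]
        exact h0.symm
      rw [← hI1, h5, integral_zero_measure]
    rw [this, ← h0]
    simp
  · have h5 := h3 (Z1 / Z)
    have h6 : 2 * (Z1 / Z) * Z1 - (Z1 / Z) ^ 2 * Z = Z1 ^ 2 / Z := by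
      field_simp
      ring
    rw [h6] at h5
    have h7 : Z1 ^ 2 / Z ≤ repulsionProb d (n + 2) r + v * Z1 := by linarith
    rwa [div_le_iff₀ h0, mul_comm] at h7

/-- In terms of ratios the previous inequality reads Z_{k+1}/Z_k ≤ Z_{k+2}/Z_{k+1} + v; iterate it
downwards from `n`. Products replace the ratios because some Z_k may vanish. -/
theorem repulsionProb_succ_le_of_le {n : ℕ} {r b : ℝ} (hb : 0 ≤ b)
    (h : repulsionProb d (n + 1) r ≤ b * repulsionProb d n r) (j k : ℕ) (hjk : k + j = n) :
    repulsionProb d (k + 1) r ≤ (b + j * ballVolume d r) * repulsionProb d k r := by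
  induction j generalizing k with
  | zero =>
    obtain rfl : k = n := by omega
    simpa using h
  | succ j ih =>
    have h1 := ih (k + 1) (by omega)
    have h2 := repulsionProb_succ_sq_le (d := d) k r
    rcases (repulsionProb_nonneg d (k + 1) r).eq_or_lt with h0 | h0
    · rw [← h0]
      exact mul_nonneg (add_nonneg hb (mul_nonneg (Nat.cast_nonneg _) measureReal_nonneg))
        (repulsionProb_nonneg _ _ _)
    · have h3 : repulsionProb d (k + 1) r * repulsionProb d (k + 1) r ≤
          ((b + (j + 1 : ℕ) * ballVolume d r) * repulsionProb d k r) *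
            repulsionProb d (k + 1) r := by
        calc _ = repulsionProb d (k + 1) r ^ 2 := by ring
          _ ≤ _ := h2
          _ ≤ repulsionProb d k r * ((b + j * ballVolume d r) * repulsionProb d (k + 1) r +
              ballVolume d r * repulsionProb d (k + 1) r) :=
            mul_le_mul_of_nonneg_left (by linarith) (repulsionProb_nonneg _ _ _)
          _ = _ := by push_cast; ring
      exact le_of_mul_le_mul_right h3 h0

/-- Exchange the integrals: a fixed point is missed by each of the `n` independent balls with
probability 1 - v. -/
theorem integral_uncovered_uniform (d n : ℕ) (r : ℝ) :
    ∫ x, (1 - unionVolume r x) ∂uniformCenters d n = (1 - ballVolume d r) ^ n := by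
  let T := UnitAddTorus (Fin d)
  let S : Set ((Fin n → T) × T) := {p | ∀ i, r < torusDist p.2 (p.1 i)}
  have hS : MeasurableSet S := by
    have h : S = ⋂ i, {p | r < torusDist p.2 (p.1 i)} := by
      ext p
      simp [S]
    rw [h]
    exact MeasurableSet.iInter fun i => measurableSet_lt measurable_const
      (measurable_torusDist_comp measurable_snd ((measurable_pi_apply i).comp measurable_fst))
  have h1 : ∀ x, ∫ y, S.indicator (fun _ => (1 : ℝ)) (x, y) = 1 - unionVolume r x := by
    intro x
    rw [← volume_real_uncovered]
    exact integral_indicator_one (measurable_prodMk_left hS)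
  have h2 : ∀ y, ∫ x, S.indicator (fun _ => (1 : ℝ)) (x, y) ∂uniformCenters d n =
      (1 - ballVolume d r) ^ n := by
    intro y
    have h3 : (fun x : Fin n → T => (x, y)) ⁻¹' S = Set.univ.pi fun _ => (torusBall y r)ᶜ := by
      ext x
      simp [S, torusBall, torusDist_comm]
    refine (integral_indicator_one (measurable_prodMk_right hS)).trans ?_
    rw [h3, measureReal_def, uniformCenters, Measure.pi_pi, ENNReal.toReal_prod,
      Finset.prod_const, ← measureReal_def,
      probReal_compl_eq_one_sub (measurableSet_torusBall _ _), volume_real_torusBall]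
    simp
  simp_rw [← h1]
  rw [integral_integral_swap]
  · simp_rw [h2]
    simp
  · exact (integrable_const (1 : ℝ)).indicator hS

theorem integral_cond_unionVolume {n : ℕ} {r : ℝ} (h : 0 < repulsionProb d n r) :
    ∫ x, unionVolume r x ∂(ProbabilityTheory.cond (uniformCenters d n) (repulsionEvent d n r)) =
      1 - repulsionProb d (n + 1) r / repulsionProb d n r := by
  have hZ : (uniformCenters d n) (repulsionEvent d n r) ≠ 0 := fun h0 => by
    simp [repulsionProb, measureReal_def, h0] at h
  have := ProbabilityTheory.cond_isProbabilityMeasure hZ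
  have h1 : ∫ x, (1 - unionVolume r x) ∂(ProbabilityTheory.cond (uniformCenters d n)
      (repulsionEvent d n r)) = repulsionProb d (n + 1) r / repulsionProb d n r := by
    rw [ProbabilityTheory.cond, integral_smul_measure, ← repulsionProb_succ, ENNReal.toReal_inv,
      smul_eq_mul, ← measureReal_def, ← repulsionProb, div_eq_inv_mul]
  rw [integral_sub (integrable_const _) (integrable_unionVolume d n r _)] at h1
  simp only [integral_const, probReal_univ, smul_eq_mul, mul_one] at h1
  linarith

/-- Conditioning on repulsion decreases the expected covered volume as soon as inserting an
`(n+1)`-st repelling point is more likely than for independent points. -/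
theorem integral_cond_unionVolume_lt {n : ℕ} {r : ℝ}
    (h : (1 - ballVolume d r) ^ n * repulsionProb d n r < repulsionProb d (n + 1) r)
    (h0 : 0 < repulsionProb d n r) :
    0 < uniformCenters d n (repulsionEvent d n r) ∧
      ∫ x, unionVolume r x ∂(ProbabilityTheory.cond (uniformCenters d n) (repulsionEvent d n r)) <
        ∫ x, unionVolume r x ∂(uniformCenters d n) := by
  refine ⟨(ENNReal.toReal_pos_iff.1 h0).1, ?_⟩
  have h1 := integral_uncovered_uniform d n r
  rw [integral_sub (integrable_const _) (integrable_unionVolume d n r _)] at h1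
  simp only [integral_const, probReal_univ, smul_eq_mul, mul_one] at h1
  rw [integral_cond_unionVolume h0]
  have h2 := (lt_div_iff₀ h0).2 h
  linarith

theorem repulsionProb_pos_of_succ {n : ℕ} {r : ℝ} (h : 0 < repulsionProb d (n + 1) r) :
    0 < repulsionProb d n r := by
  refine (repulsionProb_nonneg d n r).lt_of_ne fun h0 => ?_
  have h1 := repulsionProb_succ_sq_le (d := d) n r
  rw [← h0, zero_mul] at h1
  nlinarith

end Canonical

/-! ### Subdivision and magnification of the torus -/

section Torus

variable {d : ℕ}

theorem UnitAddCircle.norm_coe_le (t : ℝ) : ‖(t : UnitAddCircle)‖ ≤ |t| := by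
  rw [UnitAddCircle.norm_eq]
  simpa using round_le t 0

theorem UnitAddCircle.min_le_norm_coe (t : ℝ) :
    min |t| (1 - |t|) ≤ ‖(t : UnitAddCircle)‖ := by
  rw [UnitAddCircle.norm_eq]
  rcases eq_or_ne (round t) 0 with h | h
  · simp [h]
  · refine (min_le_right _ _).trans ?_
    have h1 : (1 : ℝ) ≤ |(round t : ℝ)| := by
      rw [← Int.cast_abs]
      exact_mod_cast Int.one_le_abs h
    have h2 := abs_sub_abs_le_abs_sub (round t : ℝ) t
    rw [abs_sub_comm] at h2
    linarith

theorem norm_le_torusDist (x y : UnitAddTorus (Fin d)) (i : Fin d) :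
    ‖x i - y i‖ ≤ torusDist x y := by
  refine Real.le_sqrt_of_sq_le ?_
  exact Finset.single_le_sum (f := fun i => ‖x i - y i‖ ^ 2) (fun i _ => sq_nonneg _)
    (Finset.mem_univ i)

/-- Coordinates in `(0, 1]` of a point of the unit torus. -/
def torusRep (x : UnitAddTorus (Fin d)) (i : Fin d) : ℝ := AddCircle.equivIoc (1 : ℝ) 0 (x i)

theorem torusRep_mem (x : UnitAddTorus (Fin d)) (i : Fin d) :
    torusRep x i ∈ Set.Ioc (0 : ℝ) 1 := by
  simpa [torusRep] using (AddCircle.equivIoc (1 : ℝ) 0 (x i)).2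

theorem coe_torusRep (x : UnitAddTorus (Fin d)) (i : Fin d) :
    ((torusRep x i : ℝ) : UnitAddCircle) = x i :=
  (AddCircle.equivIoc (1 : ℝ) 0).symm_apply_apply (x i)

theorem torusRep_coe {y : Fin d → ℝ} (hy : ∀ i, y i ∈ Set.Ioc (0 : ℝ) 1) :
    torusRep (fun i => (y i : UnitAddCircle)) = y := by
  funext i
  have h := AddCircle.equivIoc_coe_eq (p := (1 : ℝ)) (a := 0) (x := y i) (by simpa using hy i)
  rw [torusRep, h]

theorem measurable_torusRep : Measurable (torusRep : UnitAddTorus (Fin d) → Fin d → ℝ) :=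
  measurable_pi_lambda _ fun i => measurable_subtype_coe.comp
    ((AddCircle.measurableEquivIoc (1 : ℝ) 0).measurable.comp (measurable_pi_apply i))

theorem measurable_coe_torus :
    Measurable fun (y : Fin d → ℝ) (i : Fin d) => (y i : UnitAddCircle) :=
  measurable_pi_lambda _ fun i => AddCircle.measurable_mk'.comp (measurable_pi_apply i)

/-- The fundamental domain may start anywhere: `a = 0` suits the cubes, `a = -1/2` a ball around the
origin. -/
theorem volume_torus_eq (a : ℝ) {E : Set (UnitAddTorus (Fin d))} (hE : MeasurableSet E) :
    volume E = volume {y : Fin d → ℝ | (∀ i, y i ∈ Set.Ioc a (a + 1)) ∧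
      (fun i => (y i : UnitAddCircle)) ∈ E} := by
  have h := measurePreserving_pi (fun _ : Fin d => (volume : Measure ℝ).restrict (Set.Ioc a (a + 1)))
    (fun _ => (volume : Measure UnitAddCircle)) (fun _ => UnitAddCircle.measurePreserving_mk a)
  have h1 := h.measure_preimage hE.nullMeasurableSet
  rw [← Measure.restrict_pi_pi, Measure.restrict_apply (h.measurable hE)] at h1
  rw [volume_pi, ← h1, volume_pi]
  congr 1
  ext y
  simp only [Set.mem_inter_iff, Set.mem_preimage, Set.mem_pi, Set.mem_univ, true_imp_iff,
    Set.mem_ofPred_eq]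
  exact and_comm

theorem torusDist_le_rep (x y : UnitAddTorus (Fin d)) :
    torusDist x y ≤ Real.sqrt (∑ i, |torusRep x i - torusRep y i| ^ 2) := by
  refine Real.sqrt_le_sqrt (Finset.sum_le_sum fun i _ => ?_)
  refine pow_le_pow_left₀ (norm_nonneg _) ?_ 2
  rw [← coe_torusRep x i, ← coe_torusRep y i, ← AddCircle.coe_sub]
  exact UnitAddCircle.norm_coe_le _

/-- The cubes of side `1 / m` that subdivide the torus. -/
def subcube (m : ℕ) (b : Fin d → Fin m) : Set (UnitAddTorus (Fin d)) :=
  {x | ∀ i, torusRep x i ∈ Set.Ioc ((b i : ℝ) / m) (((b i : ℝ) + 1) / m)}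

theorem measurableSet_subcube (m : ℕ) (b : Fin d → Fin m) : MeasurableSet (subcube m b) := by
  have h : subcube m b = ⋂ i, (fun x => torusRep x i) ⁻¹'
      Set.Ioc ((b i : ℝ) / m) (((b i : ℝ) + 1) / m) := by
    ext x
    rw [Set.mem_iInter]
    rfl
  rw [h]
  exact MeasurableSet.iInter fun i =>
    ((measurable_pi_apply i).comp measurable_torusRep) measurableSet_Ioc

theorem biUnion_subcube {m : ℕ} (hm : 0 < m) :
    ⋃ b ∈ (Finset.univ : Finset (Fin d → Fin m)), subcube m b = Set.univ := by
  rw [Set.eq_univ_iff_forall]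
  intro x
  simp only [Finset.mem_univ, Set.iUnion_true, Set.mem_iUnion]
  have hm' : (0 : ℝ) < m := by exact_mod_cast hm
  have h : ∀ i, ∃ j : Fin m, torusRep x i ∈ Set.Ioc ((j : ℝ) / m) (((j : ℝ) + 1) / m) := by
    intro i
    obtain ⟨h0, h1⟩ := torusRep_mem x i
    have hc : 0 < ⌈m * torusRep x i⌉₊ := Nat.ceil_pos.2 (by positivity)
    have hc1 : ⌈m * torusRep x i⌉₊ ≤ m := Nat.ceil_le.2 (by nlinarith)
    obtain ⟨j, hj⟩ := Nat.exists_eq_succ_of_ne_zero hc.ne'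
    have h2 : (j : ℝ) < m * torusRep x i := Nat.lt_ceil.1 (by omega)
    have h3 : m * torusRep x i ≤ (j : ℝ) + 1 := by
      have := Nat.le_ceil (m * torusRep x i)
      rw [hj] at this
      exact_mod_cast this
    refine ⟨⟨j, by omega⟩, ?_, ?_⟩
    · rw [div_lt_iff₀ hm']
      linarith
    · rw [le_div_iff₀ hm']
      linarith
  choose b hb using h
  exact ⟨b, hb⟩

theorem abs_sub_lt_of_mem_subcube {m : ℕ} (b : Fin d → Fin m)
    {x y : UnitAddTorus (Fin d)} (hx : x ∈ subcube m b) (hy : y ∈ subcube m b) (i : Fin d) :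
    |torusRep x i - torusRep y i| < 1 / m := by
  have h : ((b i : ℝ) + 1) / m = (b i : ℝ) / m + 1 / m := add_div _ _ _
  have h1 := hx i
  have h2 := hy i
  rw [h] at h1 h2
  rw [abs_lt]
  constructor <;> linarith [h1.1, h1.2, h2.1, h2.2]

/-- The magnification by `κ` of the cube with index `b`, placed at the corner of the torus. -/
def magnify (m : ℕ) (b : Fin d → Fin m) (κ : ℝ) (x : UnitAddTorus (Fin d)) :
    UnitAddTorus (Fin d) :=
  fun i => ((κ * (torusRep x i - (b i : ℝ) / m) : ℝ) : UnitAddCircle)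

theorem measurable_magnify (m : ℕ) (b : Fin d → Fin m) (κ : ℝ) :
    Measurable (magnify m b κ) := by
  refine measurable_coe_torus.comp (measurable_pi_lambda _ fun i => ?_)
  exact (((measurable_pi_apply i).comp measurable_torusRep).sub_const _).const_mul _

/-- As κ ≤ m, the magnified cube fits into one fundamental domain without overlap, so only the
Jacobian κ^{-d} appears. -/
theorem map_magnify_le {m : ℕ} (hm : 0 < m) (b : Fin d → Fin m) {κ : ℝ} (hκ : 0 < κ)
    (hκm : κ ≤ m) :
    ((volume : Measure (UnitAddTorus (Fin d))).restrict (subcube m b)).map (magnify m b κ) ≤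
      ENNReal.ofReal ((κ ^ d)⁻¹) • volume := by
  have hm' : (0 : ℝ) < m := by exact_mod_cast hm
  refine Measure.le_iff.2 fun E hE => ?_
  have hF := measurable_magnify m b κ
  rw [Measure.map_apply hF hE, Measure.restrict_apply (hF hE),
    volume_torus_eq 0 ((hF hE).inter (measurableSet_subcube m b)), Measure.smul_apply,
    volume_torus_eq 0 hE, smul_eq_mul]
  set E' := {y : Fin d → ℝ | (∀ i, y i ∈ Set.Ioc (0 : ℝ) (0 + 1)) ∧
    (fun i => (y i : UnitAddCircle)) ∈ E} with hE'
  let c : Fin d → ℝ := fun i => -((b i : ℝ) / m)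
  have h1 : volume ((fun y : Fin d → ℝ => y + c) ⁻¹' ((κ • ·) ⁻¹' E')) =
      ENNReal.ofReal ((κ ^ d)⁻¹) * volume E' := by
    rw [measure_preimage_add_right, Measure.addHaar_preimage_smul _ hκ.ne']
    simp [abs_of_pos hκ]
  rw [← h1]
  refine measure_mono fun y hy => ?_
  obtain ⟨hy0, hyE, hyb⟩ := hy
  have hrep := torusRep_coe (y := y) (by simpa using hy0)
  have h2 : ∀ i, y i ∈ Set.Ioc ((b i : ℝ) / m) (((b i : ℝ) + 1) / m) := fun i => by
    have := hyb i
    rwa [hrep] at this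
  refine ⟨fun i => ?_, ?_⟩
  · have h3 := h2 i
    have h : ((b i : ℝ) + 1) / m = (b i : ℝ) / m + 1 / m := add_div _ _ _
    rw [h] at h3
    simp only [Pi.smul_apply, Pi.add_apply, smul_eq_mul, c]
    refine ⟨mul_pos hκ (by linarith [h3.1]), ?_⟩
    calc κ * (y i + -((b i : ℝ) / m)) ≤ m * (1 / m) := by
          refine mul_le_mul hκm (by linarith [h3.2]) (by linarith [h3.1]) hm'.le
      _ = 0 + 1 := by field_simp; ring
  · have h3 : magnify m b κ (fun i => (y i : UnitAddCircle)) ∈ E := hyE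
    unfold magnify at h3
    rw [hrep] at h3
    simpa [c, sub_eq_add_neg] using h3

/-- The magnified cube has side at most 1 - r, so a shortcut around the torus is still longer than
`r`; otherwise distances just scale by κ. -/
theorem lt_torusDist_magnify {m : ℕ} (b : Fin d → Fin m) {κ r r' : ℝ} (hκ : 0 < κ)
    (hr : κ * r' = r) (hκm : κ * (1 / m) ≤ 1 - r) {x y : UnitAddTorus (Fin d)}
    (hx : x ∈ subcube m b) (hy : y ∈ subcube m b) (hxy : r' < torusDist x y) :
    r < torusDist (magnify m b κ x) (magnify m b κ y) := by
  set t : Fin d → ℝ := fun i => κ * (torusRep x i - torusRep y i) with ht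
  have hF : ∀ i, magnify m b κ x i - magnify m b κ y i = ((t i : ℝ) : UnitAddCircle) := fun i => by
    simp only [magnify, ht]
    rw [← AddCircle.coe_sub]
    congr 1
    ring
  have habs : ∀ i, |t i| < 1 - r := fun i => by
    refine lt_of_lt_of_le ?_ hκm
    rw [ht]
    simp only
    rw [abs_mul, abs_of_pos hκ]
    exact mul_lt_mul_of_pos_left (abs_sub_lt_of_mem_subcube b hx hy i) hκ
  -- If no coordinate difference exceeds 1/2 there is no wrap-around. If one does, its circle norm
  -- is at least 1 - |t i| > r, which alone suffices.
  by_cases hc : ∀ i, |t i| ≤ 1 - |t i|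
  · have h1 : κ * torusDist x y ≤ torusDist (magnify m b κ x) (magnify m b κ y) := by
      have h2 : κ * Real.sqrt (∑ i, |torusRep x i - torusRep y i| ^ 2) =
          Real.sqrt (∑ i, |t i| ^ 2) := by
        nth_rewrite 1 [← Real.sqrt_sq hκ.le]
        rw [← Real.sqrt_mul (sq_nonneg _), Finset.mul_sum]
        simp only [ht, abs_mul, abs_of_pos hκ, mul_pow]
      refine (mul_le_mul_of_nonneg_left (torusDist_le_rep x y) hκ.le).trans ?_
      rw [h2]
      refine Real.sqrt_le_sqrt (Finset.sum_le_sum fun i _ => ?_)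
      refine pow_le_pow_left₀ (abs_nonneg _) ?_ 2
      rw [hF]
      exact (le_min le_rfl (hc i)).trans (UnitAddCircle.min_le_norm_coe _)
    rw [← hr]
    exact (mul_lt_mul_of_pos_left hxy hκ).trans_le h1
  · push Not at hc
    obtain ⟨i, hi⟩ := hc
    have h1 := norm_le_torusDist (magnify m b κ x) (magnify m b κ y) i
    rw [hF] at h1
    have h2 := UnitAddCircle.min_le_norm_coe (t i)
    rw [min_eq_right hi.le] at h2
    linarith [habs i]

theorem repulsionProb_eq_packInt (k : ℕ) (r : ℝ) :
    ENNReal.ofReal (repulsionProb d k r) = packInt (volume : Measure (UnitAddTorus (Fin d)))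
      (fun x y => r < torusDist x y) k Set.univ := by
  rw [packInt_eq_pi _ (measurableSet_torusDist_gt d r)
    (fun x y h => by rwa [torusDist_comm]) k MeasurableSet.univ, repulsionProb,
    ofReal_measureReal]
  simp [uniformCenters, repulsionEvent]

/-- The grand canonical partition function of hard spheres with minimal distance `r` and fugacity
`z` in the unit torus. -/
def torusPartition (d : ℕ) (r z : ℝ) : ℝ := ∑' k : ℕ, z ^ k * repulsionProb d k r / k !

theorem torusPartition_term_nonneg (r : ℝ) {z : ℝ} (hz : 0 ≤ z) (k : ℕ) :
    0 ≤ z ^ k * repulsionProb d k r / k ! :=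
  div_nonneg (mul_nonneg (pow_nonneg hz k) (repulsionProb_nonneg _ _ _)) (Nat.cast_nonneg _)

theorem torusPartition_term_le (r : ℝ) {z : ℝ} (hz : 0 ≤ z) (k : ℕ) :
    z ^ k * repulsionProb d k r / k ! ≤ z ^ k / k ! :=
  div_le_div_of_nonneg_right (mul_le_of_le_one_right (pow_nonneg hz k)
    (repulsionProb_le_one _ _ _)) (Nat.cast_nonneg _)

theorem summable_torusPartition (d : ℕ) (r : ℝ) {z : ℝ} (hz : 0 ≤ z) :
    Summable fun k : ℕ => z ^ k * repulsionProb d k r / k ! :=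
  Summable.of_nonneg_of_le (torusPartition_term_nonneg r hz) (torusPartition_term_le r hz)
    (Real.summable_pow_div_factorial z)

theorem torusPartition_le_exp (d : ℕ) (r : ℝ) {z : ℝ} (hz : 0 ≤ z) :
    torusPartition d r z ≤ Real.exp z := by
  rw [Real.exp_eq_exp_ℝ, NormedSpace.exp_eq_tsum_div]
  exact (summable_torusPartition d r hz).tsum_le_tsum (torusPartition_term_le r hz)
    (Real.summable_pow_div_factorial z)

theorem ofReal_torusPartition (r : ℝ) {z : ℝ} (hz : 0 ≤ z) :
    ENNReal.ofReal (torusPartition d r z) =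
      partitionFn (ENNReal.ofReal z • (volume : Measure (UnitAddTorus (Fin d))))
        (fun x y => r < torusDist x y) Set.univ := by
  rw [torusPartition, ENNReal.ofReal_tsum_of_nonneg (torusPartition_term_nonneg r hz)
    (summable_torusPartition d r hz), partitionFn]
  refine tsum_congr fun k => ?_
  rw [packInt_smul _ _ ENNReal.ofReal_ne_top, ← repulsionProb_eq_packInt,
    ENNReal.ofReal_div_of_pos (by exact_mod_cast k.factorial_pos),
    ENNReal.ofReal_mul (pow_nonneg hz k), ENNReal.ofReal_pow hz, ENNReal.ofReal_natCast]

theorem one_le_torusPartition (d : ℕ) (r : ℝ) {z : ℝ} (hz : 0 ≤ z) :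
    1 ≤ torusPartition d r z := by
  have h := one_le_partitionFn (ENNReal.ofReal z • (volume : Measure (UnitAddTorus (Fin d))))
    (fun x y => r < torusDist x y) Set.univ
  rw [← ofReal_torusPartition r hz] at h
  exact ENNReal.one_le_ofReal.1 h

theorem isFiniteMeasure_smul_volume (z : ℝ) : IsFiniteMeasure
    (ENNReal.ofReal z • (volume : Measure (UnitAddTorus (Fin d)))) :=
  Measure.smul_finite _ ENNReal.ofReal_ne_top

/-- Subdividing the torus into `m ^ d` cubes and magnifying each of them. -/
theorem torusPartition_le_pow {m : ℕ} (hm : 0 < m) {r r' z z' : ℝ} (hr : 0 < r) (hr' : 0 < r')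
    (hz : 0 ≤ z) (hz' : 0 ≤ z') (hzz : z' * r' ^ d = z * r ^ d) (hrm : r ≤ (1 - r) * m * r') :
    torusPartition d r' z' ≤ torusPartition d r z ^ m ^ d := by
  have hm' : (0 : ℝ) < m := by exact_mod_cast hm
  have := isFiniteMeasure_smul_volume (d := d) z'
  have := isFiniteMeasure_smul_volume (d := d) z
  set κ := r / r' with hκ
  have hκ0 : 0 < κ := div_pos hr hr'
  have hκr : κ * r' = r := div_mul_cancel₀ r hr'.ne'
  have hκm : κ * (1 / m) ≤ 1 - r := by
    rw [hκ, mul_one_div, div_div, div_le_iff₀ (by positivity)]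
    linarith
  have hκm' : κ ≤ m := by
    rw [mul_one_div, div_le_iff₀ hm'] at hκm
    nlinarith
  have h0 : 0 ≤ torusPartition d r z := zero_le_one.trans (one_le_torusPartition d r hz)
  rw [← ENNReal.ofReal_le_ofReal_iff (pow_nonneg h0 _), ENNReal.ofReal_pow h0,
    ofReal_torusPartition r' hz', ofReal_torusPartition r hz, ← biUnion_subcube hm]
  refine (partitionFn_biUnion_le _ (measurableSet_torusDist_gt d r') _
    (measurableSet_subcube m)).trans ?_
  rw [biUnion_subcube hm]
  refine (Finset.prod_le_pow_card _ _ (partitionFn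
    (ENNReal.ofReal z • (volume : Measure (UnitAddTorus (Fin d)))) (fun x y => r < torusDist x y) Set.univ) fun b _ => ?_).trans (le_of_eq (by simp))
  refine ENNReal.tsum_le_tsum fun k => ENNReal.div_le_div_right ?_ _
  refine packInt_le_of_map _ _ (measurableSet_torusDist_gt d r') (measurableSet_torusDist_gt d r)
    (measurable_magnify m b κ) k (measurableSet_subcube m b) MeasurableSet.univ
    (Set.mapsTo_univ _ _) (fun x hx y hy hxy => lt_torusDist_magnify b hκ0 hκr hκm hx hy hxy)
    ?_
  -- The equality `hzz` of fugacities per unit cell r^d says precisely that z' κ^{-d} = z.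
  rw [Measure.restrict_smul, Measure.map_smul]
  refine le_trans (b := ENNReal.ofReal z' • ENNReal.ofReal ((κ ^ d)⁻¹) • volume)
    (Measure.le_iff'.2 fun s => ?_) (le_of_eq ?_)
  · rw [Measure.smul_apply, Measure.smul_apply, smul_eq_mul, smul_eq_mul]
    exact mul_le_mul_right (map_magnify_le hm b hκ0 hκm' s) _
  rw [smul_smul, ← ENNReal.ofReal_mul hz']
  congr 2
  rw [hκ, div_pow, inv_div]
  field_simp
  linarith

theorem partitionFn_eq_of_not_rel {X : Type*} [MeasurableSpace X] (ν : Measure X)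
    {R : X → X → Prop} {A : Set X} (hA : MeasurableSet A)
    (h : ∀ x ∈ A, ∀ y ∈ A, ¬ R x y) : partitionFn ν R A = 1 + ν A := by
  rw [partitionFn, tsum_eq_sum (s := Finset.range 2)]
  · simp [Finset.sum_range_succ, packInt_zero, packInt_one]
  · intro k hk
    obtain ⟨k, rfl⟩ := Nat.exists_eq_add_of_le (not_lt.1 (mt Finset.mem_range.2 hk))
    have h1 : packInt ν R (2 + k) A = 0 := by
      rw [show 2 + k = k + 1 + 1 by ring, packInt_succ]
      refine (setLIntegral_congr_fun (g := fun _ => 0) hA fun x hx => ?_).trans (by simp)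
      have h2 : A ∩ {y | R x y} = ∅ := by
        ext y
        simp only [Set.mem_inter_iff, Set.mem_ofPred_eq, Set.mem_empty_iff_false, iff_false]
        exact fun hy => h x hx y hy.1 hy.2
      simp [h2, packInt_succ]
    simp [h1]

/-- The cubes have diameter at most `r`, so each holds at most one centre. -/
theorem torusPartition_le_one_add_pow {m : ℕ} (hm : 0 < m) {r z : ℝ} (hz : 0 ≤ z)
    (hr : (d : ℝ) * (1 / m) ^ 2 ≤ r ^ 2) (hr0 : 0 ≤ r) :
    torusPartition d r z ≤ (1 + z) ^ m ^ d := by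
  have := isFiniteMeasure_smul_volume (d := d) z
  rw [← ENNReal.ofReal_le_ofReal_iff (by positivity), ENNReal.ofReal_pow (by positivity),
    ofReal_torusPartition r hz, ← biUnion_subcube hm]
  refine (partitionFn_biUnion_le _ (measurableSet_torusDist_gt d r) _
    (measurableSet_subcube m)).trans ?_
  refine (Finset.prod_le_pow_card _ _ (ENNReal.ofReal (1 + z)) fun b _ => ?_).trans
    (le_of_eq (by simp))
  rw [partitionFn_eq_of_not_rel _ (measurableSet_subcube m b),
    ENNReal.ofReal_add zero_le_one hz, ENNReal.ofReal_one, Measure.smul_apply, smul_eq_mul]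
  · gcongr
    exact mul_le_of_le_one_right' prob_le_one
  · intro x hx y hy
    refine not_lt.2 ((torusDist_le_rep x y).trans ?_)
    refine Real.sqrt_le_iff.2 ⟨hr0, le_trans ?_ hr⟩
    calc ∑ i, |torusRep x i - torusRep y i| ^ 2 ≤ ∑ _i : Fin d, (1 / (m : ℝ)) ^ 2 :=
          Finset.sum_le_sum fun i _ => pow_le_pow_left₀ (abs_nonneg _)
            (abs_sub_lt_of_mem_subcube b hx hy i).le 2
      _ = d * (1 / (m : ℝ)) ^ 2 := by simp

end Torus

/-! ### The thermodynamic limit of the pressure -/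

section Pressure

/-- The pressure of the hard-sphere gas with minimal distance `r` in the unit torus, in units of
`r ^ d`, as a function of the chemical potential. -/
def pressure (d : ℕ) (r μ : ℝ) : ℝ := r ^ d * Real.log (torusPartition d r (Real.exp μ / r ^ d))

variable {d : ℕ}

theorem fugacity_nonneg {r : ℝ} (hr : 0 < r) (d : ℕ) (μ : ℝ) : 0 ≤ Real.exp μ / r ^ d := by
  positivity

theorem pressure_nonneg {r : ℝ} (hr : 0 < r) (μ : ℝ) : 0 ≤ pressure d r μ :=
  mul_nonneg (by positivity) (Real.log_nonneg (one_le_torusPartition d r (fugacity_nonneg hr d μ)))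

theorem exp_pressure {r : ℝ} (hr : 0 < r) (μ : ℝ) :
    Real.exp (pressure d r μ / r ^ d) = torusPartition d r (Real.exp μ / r ^ d) := by
  have h := one_le_torusPartition d r (fugacity_nonneg hr d μ)
  rw [pressure, mul_div_cancel_left₀ _ (by positivity), Real.exp_log (by linarith)]

theorem pressure_le_mul {r r' : ℝ} (hr : 0 < r) (hr1 : r < 1) (hr' : 0 < r') (μ : ℝ) :
    pressure d r' μ ≤ (1 / (1 - r) + r' / r) ^ d * pressure d r μ := by
  have h1r : 0 < 1 - r := by linarith
  -- The fewest cubes per side for which the magnified cubes have side at most 1 - r.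
  set m := ⌈r / ((1 - r) * r')⌉₊ with hm
  have hm0 : 0 < m := Nat.ceil_pos.2 (by positivity)
  have hm1 : r / ((1 - r) * r') ≤ m := Nat.le_ceil _
  have hm2 : (m : ℝ) < r / ((1 - r) * r') + 1 := Nat.ceil_lt_add_one (by positivity)
  have h := torusPartition_le_pow (d := d) hm0 hr hr' (fugacity_nonneg hr d μ)
    (fugacity_nonneg hr' d μ) (by field_simp) (by
      rw [div_le_iff₀ (by positivity)] at hm1
      linarith)
  have h0 := one_le_torusPartition d r' (fugacity_nonneg hr' d μ)
  have h2 := Real.log_le_log (by linarith) h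
  rw [Real.log_pow] at h2
  have h3 : r' * m / r ≤ 1 / (1 - r) + r' / r := by
    have h4 : r' * m / r ≤ r' * (r / ((1 - r) * r') + 1) / r := by gcongr
    refine h4.trans (le_of_eq ?_)
    field_simp
  calc pressure d r' μ ≤ r' ^ d * ((m ^ d : ℕ) *
        Real.log (torusPartition d r (Real.exp μ / r ^ d))) :=
        mul_le_mul_of_nonneg_left h2 (by positivity)
    _ = (r' * m / r) ^ d * pressure d r μ := by
        rw [pressure, div_pow, mul_pow]
        push_cast
        field_simp
    _ ≤ _ := by
        gcongr
        exact pressure_nonneg hr μ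

theorem tendsto_tiling_factor {r : ℝ} (d : ℕ) (p : ℝ) : Tendsto
    (fun r' : ℝ => (1 / (1 - r) + r' / r) ^ d * p) (𝓝[>] 0) (𝓝 ((1 / (1 - r)) ^ d * p)) := by
  have h : Continuous fun r' : ℝ => (1 / (1 - r) + r' / r) ^ d * p := by fun_prop
  have h1 := h.tendsto 0
  simp only [zero_div, add_zero] at h1
  exact h1.mono_left nhdsWithin_le_nhds

/-- A Fekete argument: by `pressure_le_mul`, as r' → 0 the pressure is eventually at most any number
above (1-r)^{-d} times the pressure at `r`. The limit is the infimum of these corrected pressures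
over 0 < r < 1. -/
theorem exists_tendsto_pressure (d : ℕ) (μ : ℝ) :
    ∃ P, Tendsto (fun r => pressure d r μ) (𝓝[>] 0) (𝓝 P) := by
  set S := (fun r => (1 / (1 - r)) ^ d * pressure d r μ) '' Set.Ioo 0 1 with hS
  have hb : ∀ x ∈ S, 0 ≤ x := by
    rintro _ ⟨r, hr, rfl⟩
    have : 0 < 1 - r := by linarith [hr.2]
    exact mul_nonneg (by positivity) (pressure_nonneg hr.1 μ)
  have hne : S.Nonempty := ⟨_, 1 / 2, by norm_num, rfl⟩
  refine ⟨sInf S, tendsto_order.2 ⟨fun a ha => ?_, fun a ha => ?_⟩⟩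
  · have h1 : Tendsto (fun r : ℝ => (1 - r) ^ d * sInf S) (𝓝[>] 0) (𝓝 (sInf S)) := by
      have h : Continuous fun r : ℝ => (1 - r) ^ d * sInf S := by fun_prop
      have h1 := h.tendsto 0
      simp only [sub_zero, one_pow, one_mul] at h1
      exact h1.mono_left nhdsWithin_le_nhds
    filter_upwards [h1.eventually (lt_mem_nhds ha), Ioo_mem_nhdsGT (zero_lt_one (α := ℝ))]
      with r hr hr1
    refine hr.trans_le ?_
    have h2 : 0 < 1 - r := by linarith [hr1.2]
    have h3 : sInf S ≤ (1 / (1 - r)) ^ d * pressure d r μ := csInf_le ⟨0, hb⟩ ⟨r, hr1, rfl⟩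
    calc (1 - r) ^ d * sInf S ≤ (1 - r) ^ d * ((1 / (1 - r)) ^ d * pressure d r μ) := by gcongr
      _ = pressure d r μ := by
        rw [← mul_assoc, ← mul_pow, mul_one_div_cancel h2.ne', one_pow, one_mul]
  · obtain ⟨_, ⟨r, hr, rfl⟩, hra⟩ := exists_lt_of_csInf_lt hne ha
    filter_upwards [(tendsto_tiling_factor (r := r) d (pressure d r μ)).eventually
      (gt_mem_nhds hra), self_mem_nhdsWithin] with r' h1 h2
    exact (pressure_le_mul hr.1 hr.2 h2 μ).trans_lt h1

/-- The thermodynamic limit of the pressure. -/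
def limitPressure (d : ℕ) (μ : ℝ) : ℝ := (exists_tendsto_pressure d μ).choose

theorem tendsto_pressure (d : ℕ) (μ : ℝ) :
    Tendsto (fun r => pressure d r μ) (𝓝[>] 0) (𝓝 (limitPressure d μ)) :=
  (exists_tendsto_pressure d μ).choose_spec

theorem limitPressure_le {r : ℝ} (hr : 0 < r) (hr1 : r < 1) (μ : ℝ) :
    limitPressure d μ ≤ (1 / (1 - r)) ^ d * pressure d r μ := by
  refine le_of_tendsto_of_tendsto (tendsto_pressure d μ)
    (tendsto_tiling_factor (r := r) d (pressure d r μ)) ?_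
  filter_upwards [self_mem_nhdsWithin] with r' h
  exact pressure_le_mul hr hr1 h μ

theorem limitPressure_zero_le (d : ℕ) : limitPressure d 0 ≤ 1 := by
  refine le_of_tendsto (tendsto_pressure d 0) ?_
  filter_upwards [self_mem_nhdsWithin] with r hr
  have hr0 : (0 : ℝ) < r := hr
  have h1 := one_le_torusPartition d r (fugacity_nonneg hr0 d 0)
  have h := Real.log_le_log (by linarith) (torusPartition_le_exp d r (fugacity_nonneg hr0 d 0))
  rw [Real.log_exp, Real.exp_zero] at h
  calc pressure d r 0 ≤ r ^ d * (1 / r ^ d) := by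
        rw [pressure, Real.exp_zero]
        gcongr
    _ = 1 := by field_simp

/-- At r = 1/2 the hard core allows one centre per cube of side 1/(2(d+1)), so log Ξ is at most a
constant times log(1 + z), which is linear in μ. -/
theorem limitPressure_le_linear (d : ℕ) : ∃ K : ℝ, 0 ≤ K ∧ ∀ μ, 0 ≤ μ →
    limitPressure d μ ≤ K * (1 + μ) := by
  set m := 2 * (d + 1) with hm
  refine ⟨(m : ℝ) ^ d * (d + 1), by positivity, fun μ hμ => ?_⟩
  set z := Real.exp μ / (1 / 2 : ℝ) ^ d with hz
  have hz' : z = Real.exp μ * 2 ^ d := by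
    rw [hz, one_div, inv_pow, div_inv_eq_mul]
  have hz1 : 1 ≤ z := by
    rw [hz']
    exact one_le_mul_of_one_le_of_one_le (Real.one_le_exp hμ) (one_le_pow₀ (by norm_num))
  have hd : (d : ℝ) * (1 / (m : ℕ)) ^ 2 ≤ (1 / 2) ^ 2 := by
    rw [hm, div_pow, one_pow, mul_one_div, div_le_iff₀ (by positivity)]
    push_cast
    nlinarith [(Nat.cast_nonneg d : (0 : ℝ) ≤ d)]
  have h := torusPartition_le_one_add_pow (d := d) (m := m) (by omega) (by linarith : 0 ≤ z) hd
    (by norm_num)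
  have h1 := one_le_torusPartition d (1 / 2) (by linarith : 0 ≤ z)
  have h2 := Real.log_le_log (by linarith) h
  rw [Real.log_pow] at h2
  have h3 : Real.log (1 + z) ≤ (d + 1) * (1 + μ) := by
    calc Real.log (1 + z) ≤ Real.log (2 * z) := Real.log_le_log (by linarith) (by linarith)
      _ = (d + 1) * Real.log 2 + μ := by
        rw [hz', Real.log_mul (by norm_num) (by positivity),
          Real.log_mul (by positivity) (by positivity), Real.log_exp, Real.log_pow]
        ring
      _ ≤ (d + 1) * 1 + (d + 1) * μ := by
        have h4 : Real.log 2 ≤ 1 := by linarith [Real.log_two_lt_d9]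
        have h5 : 0 ≤ (d : ℝ) * μ := by positivity
        have h6 := mul_le_mul_of_nonneg_left h4 (by positivity : (0 : ℝ) ≤ d + 1)
        linarith
      _ = _ := by ring
  refine (limitPressure_le (r := 1 / 2) (by norm_num) (by norm_num) μ).trans ?_
  have h5 : (1 / (1 - 1 / 2 : ℝ)) ^ d * pressure d (1 / 2) μ =
      Real.log (torusPartition d (1 / 2) z) := by
    rw [pressure, ← mul_assoc, ← mul_pow]
    norm_num [hz]
  rw [h5]
  refine h2.trans ?_
  push_cast
  rw [mul_assoc]
  gcongr

end Pressure

/-! ### Concentration of the particle number against monotone weights -/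

section MainArgument

variable {d : ℕ}

/-- A discrete maximum bounds both neighbouring values, which is all the later Chernoff bounds need;
no differentiability of the pressure enters. -/
theorem exists_interior_max {f : ℕ → ℝ} {a N : ℕ} (haN : a ≤ N) (h0 : f 0 < f a)
    (hN : f N < f a) : ∃ i, i + 1 < N ∧ f i ≤ f (i + 1) ∧ f (i + 2) ≤ f (i + 1) := by
  obtain ⟨j, hj, hmax⟩ := Finset.exists_max_image (Finset.range (N + 1)) f ⟨0, by simp⟩
  have hjN := Finset.mem_range.1 hj
  have ha := hmax a (Finset.mem_range.2 (by omega))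
  have hj0 : j ≠ 0 := by
    rintro rfl
    linarith
  have hjN' : j ≠ N := by
    rintro rfl
    linarith
  obtain ⟨i, rfl⟩ := Nat.exists_eq_succ_of_ne_zero hj0
  exact ⟨i, by omega, hmax i (Finset.mem_range.2 (by omega)),
    hmax (i + 2) (Finset.mem_range.2 (by omega))⟩

/-- The hypothesis says that the weights do not increase from `a` to `n`, so each of the `n` terms
below `n` is at most some term with index up to a + 1. Tilting the fugacity by e^{-δ} bounds these
low terms, and tilting by e^{δ} bounds the tail from `n` on. -/
theorem torusPartition_le_of_antitone {n : ℕ} {r z a δ : ℝ} (hz : 0 ≤ z) (ha : 0 ≤ a)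
    (hδ : 0 ≤ δ) (h : ∀ k : ℕ, a ≤ k → k < n →
      z * repulsionProb d (k + 1) r ≤ (k + 1) * repulsionProb d k r) :
    torusPartition d r z ≤
      n * (Real.exp (δ * (a + 1)) * torusPartition d r (z * Real.exp (-δ))) +
        Real.exp (-(δ * n)) * torusPartition d r (z * Real.exp δ) := by
  set w : ℝ → ℕ → ℝ := fun z k => z ^ k * repulsionProb d k r / k ! with hw
  have hzm : 0 ≤ z * Real.exp (-δ) := by positivity
  have hzp : 0 ≤ z * Real.exp δ := by positivity
  have hscale : ∀ (z t : ℝ) (k : ℕ), w z k = Real.exp (-(t * k)) * w (z * Real.exp t) k := by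
    intro z t k
    have h1 : Real.exp (-(t * k)) * Real.exp t ^ k = 1 := by
      rw [← Real.exp_nat_mul, ← Real.exp_add, mul_comm (k : ℝ), neg_add_cancel, Real.exp_zero]
    simp only [hw]
    calc _ = (Real.exp (-(t * k)) * Real.exp t ^ k) * (z ^ k * repulsionProb d k r / k !) := by
          rw [h1, one_mul]
      _ = _ := by ring
  have hle : ∀ {z : ℝ} (_ : 0 ≤ z) (k : ℕ), w z k ≤ torusPartition d r z := fun hz k =>
    (summable_torusPartition d r hz).le_tsum k fun j _ => torusPartition_term_nonneg r hz j
  have hlow : ∀ k : ℕ, (k : ℝ) ≤ a + 1 →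
      w z k ≤ Real.exp (δ * (a + 1)) * torusPartition d r (z * Real.exp (-δ)) := by
    intro k hk
    rw [hscale z (-δ) k]
    refine mul_le_mul (Real.exp_le_exp.2 ?_) (hle hzm k) (torusPartition_term_nonneg r hzm k)
      (Real.exp_nonneg _)
    have := mul_le_mul_of_nonneg_left hk hδ
    linarith
  have hk0 : (⌈a⌉₊ : ℝ) ≤ a + 1 := (Nat.ceil_lt_add_one ha).le
  have hanti : ∀ j : ℕ, ⌈a⌉₊ + j ≤ n → w z (⌈a⌉₊ + j) ≤ w z ⌈a⌉₊ := by
    intro j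
    induction j with
    | zero => intro _; exact le_rfl
    | succ j ih =>
      intro hj
      refine le_trans ?_ (ih (by omega))
      set k := ⌈a⌉₊ + j with hk
      have hka : a ≤ k := (Nat.le_ceil a).trans (by exact_mod_cast Nat.le_add_right _ _)
      have h1 := h k hka (by omega)
      have hk1 : (0 : ℝ) < k + 1 := by positivity
      have hkf : (0 : ℝ) < k ! := by exact_mod_cast k.factorial_pos
      simp only [hw]
      rw [← add_assoc, ← hk, Nat.factorial_succ, div_le_div_iff₀ (by positivity) hkf]
      push_cast
      calc z ^ (k + 1) * repulsionProb d (k + 1) r * k !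
          = z ^ k * (z * repulsionProb d (k + 1) r) * k ! := by ring
        _ ≤ z ^ k * ((k + 1) * repulsionProb d k r) * k ! := by gcongr
        _ = _ := by ring
  have hall : ∀ k ∈ Finset.range n,
      w z k ≤ Real.exp (δ * (a + 1)) * torusPartition d r (z * Real.exp (-δ)) := by
    intro k hk
    rcases le_total k ⌈a⌉₊ with h1 | h1
    · exact hlow k ((Nat.cast_le.2 h1).trans hk0)
    · obtain ⟨j, rfl⟩ := Nat.exists_eq_add_of_le h1
      exact (hanti j (Finset.mem_range.1 hk).le).trans (hlow _ hk0)
  have hs := summable_torusPartition d r hz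
  have hsp := summable_torusPartition d r hzp
  have h1 : torusPartition d r z = ∑ k ∈ Finset.range n, w z k + ∑' k, w z (k + n) :=
    (hs.sum_add_tsum_nat_add n).symm
  rw [h1]
  refine add_le_add ?_ ?_
  · refine (Finset.sum_le_card_nsmul _ _ _ hall).trans (le_of_eq ?_)
    rw [Finset.card_range, nsmul_eq_mul]
  · have h2 : ∑' k, w (z * Real.exp δ) (k + n) ≤ torusPartition d r (z * Real.exp δ) := by
      rw [torusPartition, ← hsp.sum_add_tsum_nat_add n]
      exact le_add_of_nonneg_left
        (Finset.sum_nonneg fun k _ => torusPartition_term_nonneg r hzp k)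
    refine le_trans ?_ (mul_le_mul_of_nonneg_left h2 (Real.exp_nonneg _))
    rw [← tsum_mul_left]
    refine ((summable_nat_add_iff n).2 hs).tsum_le_tsum (fun k => ?_)
      (((summable_nat_add_iff n).2 hsp).mul_left _)
    change w z (k + n) ≤ _
    rw [hscale z δ (k + n)]
    refine mul_le_mul_of_nonneg_right (Real.exp_le_exp.2 ?_) (torusPartition_term_nonneg r hzp _)
    push_cast
    have : 0 ≤ δ * k := by positivity
    linarith

theorem ballVolume_nonneg (d : ℕ) (r : ℝ) : 0 ≤ ballVolume d r := measureReal_nonneg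

theorem ballVolume_le_one (d : ℕ) (r : ℝ) : ballVolume d r ≤ 1 := measureReal_le_one

/-- If inserting a further point at density `β` is unlikely, then the weights of the grand
canonical ensemble decrease on a window of densities below `β`. -/
theorem weight_antitone {n : ℕ} {r c μ α β : ℝ} (hr : 0 < r) (hv : ballVolume d r = c * r ^ d)
    (hn : n * r ^ d = β)
    (hbad : repulsionProb d (n + 1) r ≤ (1 - ballVolume d r) ^ n * repulsionProb d n r)
    (hα : Real.exp μ * (Real.exp (-(c * β)) + c * (β - α)) ≤ α) (k : ℕ) (hk : α / r ^ d ≤ k)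
    (hkn : k < n) :
    Real.exp μ / r ^ d * repulsionProb d (k + 1) r ≤ (k + 1) * repulsionProb d k r := by
  have hrd : 0 < r ^ d := by positivity
  have hv0 := ballVolume_nonneg d r
  have hv1 := ballVolume_le_one d r
  have h1 := repulsionProb_succ_le_of_le (pow_nonneg (by linarith) n) hbad (n - k) k (by omega)
  have h2 : (1 - ballVolume d r) ^ n ≤ Real.exp (-(c * β)) := by
    calc (1 - ballVolume d r) ^ n ≤ Real.exp (-ballVolume d r) ^ n :=
          pow_le_pow_left₀ (by linarith) (Real.one_sub_le_exp_neg _) n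
      _ = _ := by
          rw [← Real.exp_nat_mul, ← hn, hv]
          congr 1
          ring
  have h3 : ((n - k : ℕ) : ℝ) * ballVolume d r ≤ c * (β - α) := by
    rw [Nat.cast_sub hkn.le, hv]
    rw [div_le_iff₀ hrd] at hk
    have hc : 0 ≤ c := by
      rw [hv] at hv0
      exact nonneg_of_mul_nonneg_left hv0 hrd
    have := mul_le_mul_of_nonneg_left hk hc
    rw [← hn]
    linarith
  have hZ := repulsionProb_nonneg d k r
  calc Real.exp μ / r ^ d * repulsionProb d (k + 1) r
      ≤ Real.exp μ / r ^ d * ((Real.exp (-(c * β)) + c * (β - α)) * repulsionProb d k r) := by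
        refine mul_le_mul_of_nonneg_left (h1.trans ?_) (by positivity)
        exact mul_le_mul_of_nonneg_right (by linarith) hZ
    _ = Real.exp μ * (Real.exp (-(c * β)) + c * (β - α)) / r ^ d * repulsionProb d k r := by ring
    _ ≤ α / r ^ d * repulsionProb d k r := by gcongr
    _ ≤ (k + 1) * repulsionProb d k r := by
        gcongr
        linarith

theorem tendsto_radius (hd : d ≠ 0) {β : ℝ} (hβ : 0 < β) :
    Tendsto (fun n : ℕ => (β / n) ^ (1 / d : ℝ)) atTop (𝓝[>] 0) := by
  refine tendsto_nhdsWithin_iff.2 ⟨?_, ?_⟩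
  · have h1 : Tendsto (fun n : ℕ => β / n) atTop (𝓝 0) :=
      tendsto_const_nhds.div_atTop tendsto_natCast_atTop_atTop
    have hp : (0 : ℝ) < 1 / d := by positivity
    have h2 := h1.rpow_const (p := 1 / d) (Or.inr hp.le)
    rwa [Real.zero_rpow hp.ne'] at h2
  · filter_upwards [eventually_gt_atTop 0] with n hn
    have : (0 : ℝ) < n := by exact_mod_cast hn
    exact Real.rpow_pos_of_pos (by positivity) _

/-- The two pressure bounds make the mass outside densities [q - δ/c, q + δ/c], with q = μ/c + 5,
exponentially small. Failure of the insertion bound at the upper edge makes the weights decrease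
across the window, so the mass inside is small too. -/
theorem eventually_insertion_of_parabola (hd : d ≠ 0) {c : ℝ} (hc : 0 < c)
    (hv : ∀ r, 0 < r → r < 1 / 2 → ballVolume d r = c * r ^ d) {μ δ : ℝ} (hμ : 0 ≤ μ)
    (hδ : 0 < δ) (hδc : δ ≤ c) (hδμ : 2 * δ * Real.exp μ ≤ 1)
    (hplus : limitPressure d (μ + δ) ≤ limitPressure d μ + δ * (μ / c + 5) + δ ^ 2 / (2 * c))
    (hminus : limitPressure d (μ - δ) ≤ limitPressure d μ - δ * (μ / c + 5) + δ ^ 2 / (2 * c)) :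
    ∀ᶠ n : ℕ in atTop, ∃ r, 0 < r ∧
      (1 - ballVolume d r) ^ n * repulsionProb d n r < repulsionProb d (n + 1) r := by
  set q := μ / c + 5 with hq
  set β := q + δ / c with hβ
  set α := q - δ / c with hα
  have hμc : 0 ≤ μ / c := by positivity
  have hδc1 : δ / c ≤ 1 := (div_le_one hc).2 hδc
  have hδc0 : 0 < δ / c := by positivity
  have hα4 : 4 ≤ α := by linarith
  have hβ0 : 0 < β := by linarith
  -- The slack 5 in q gives α ≥ 4, while the left side is at most 2: cβ ≥ μ bounds the first summand
  -- by 1, and 2δe^μ ≤ 1 bounds the second.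
  have hratio : Real.exp μ * (Real.exp (-(c * β)) + c * (β - α)) ≤ α := by
    have h1 : Real.exp μ * Real.exp (-(c * β)) ≤ 1 := by
      rw [← Real.exp_add, Real.exp_le_one_iff]
      have : c * β = μ + 5 * c + δ := by
        rw [hβ, hq]
        field_simp
      linarith
    have h2 : c * (β - α) = 2 * δ := by
      rw [hβ, hα]
      field_simp
      ring
    rw [h2, mul_add]
    linarith
  -- Write ε for this quantity. Each Chernoff bound gains δ²/(2c) = 4ε in the limit; the errors of
  -- two pressures cost less than 2ε, leaving an exponent 2ε = δ²/(4c) per unit of 1/r^d = n/β.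
  have hε : 0 < δ ^ 2 / (8 * c) := by positivity
  have hrad := tendsto_radius hd hβ0
  have hclose : ∀ x, ∀ᶠ n : ℕ in atTop,
      |pressure d ((β / n) ^ (1 / d : ℝ)) x - limitPressure d x| < δ ^ 2 / (8 * c) := fun x =>
    ((tendsto_pressure d x).comp hrad).eventually (Metric.ball_mem_nhds _ hε)
  -- Exponential decay beats the number `n` of low terms; e^δ comes from rounding the lower edge up
  -- to an integer.
  have hexp : ∀ᶠ n : ℕ in atTop,
      (n * Real.exp δ + 1) * Real.exp (-(n / β * (δ ^ 2 / (4 * c)))) < 1 := by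
    set s := δ ^ 2 / (4 * c) / β with hs
    have hs0 : 0 < s := by positivity
    have h1 : Tendsto (fun x : ℝ => x * Real.exp (-(s * x))) atTop (𝓝 0) := by
      have := Real.tendsto_pow_mul_exp_neg_atTop_nhds_zero 1
      have h2 := (this.comp (tendsto_id.const_mul_atTop hs0)).const_mul s⁻¹
      rw [mul_zero] at h2
      refine h2.congr fun x => ?_
      simp only [Function.comp, id, pow_one]
      field_simp
    have h2 : Tendsto (fun x : ℝ => Real.exp (-(s * x))) atTop (𝓝 0) :=
      Real.tendsto_exp_neg_atTop_nhds_zero.comp (tendsto_id.const_mul_atTop hs0)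
    have h3 := ((h1.const_mul (Real.exp δ)).add h2).comp
      (tendsto_natCast_atTop_atTop (R := ℝ))
    rw [mul_zero, add_zero] at h3
    filter_upwards [h3.eventually (gt_mem_nhds zero_lt_one)] with n hn
    refine lt_of_eq_of_lt ?_ hn
    simp only [Function.comp, hs]
    rw [show (n : ℝ) / β * (δ ^ 2 / (4 * c)) = δ ^ 2 / (4 * c) / β * n by ring]
    ring
  filter_upwards [hclose μ, hclose (μ + δ), hclose (μ - δ), hexp, eventually_gt_atTop 0,
    hrad.eventually (Ioo_mem_nhdsGT (by norm_num : (0 : ℝ) < 1 / 2))] with n h1 h2 h3 h4 hn hr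
  set r := (β / n) ^ (1 / d : ℝ) with hrdef
  have hn0 : (0 : ℝ) < n := by exact_mod_cast hn
  have hrd : r ^ d = β / n := by
    rw [hrdef, one_div, Real.rpow_inv_natCast_pow (by positivity) hd]
  refine ⟨r, hr.1, ?_⟩
  by_contra hbad
  rw [not_lt] at hbad
  have hrd0 : 0 < r ^ d := pow_pos hr.1 d
  have hnβ : n * r ^ d = β := by
    rw [hrd]
    field_simp
  have hV : 1 / r ^ d = n / β := by
    rw [hrd]
    field_simp
  have hmain := torusPartition_le_of_antitone (d := d) (n := n) (r := r)
    (z := Real.exp μ / r ^ d) (a := α / r ^ d) (δ := δ) (by positivity)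
    (div_nonneg (by linarith) hrd0.le) hδ.le
    (weight_antitone hr.1 (hv r hr.1 hr.2) hnβ hbad hratio)
  have e1 : Real.exp μ / r ^ d * Real.exp (-δ) = Real.exp (μ - δ) / r ^ d := by
    rw [sub_eq_add_neg, Real.exp_add]
    ring
  have e2 : Real.exp μ / r ^ d * Real.exp δ = Real.exp (μ + δ) / r ^ d := by
    rw [Real.exp_add]
    ring
  rw [e1, e2, ← exp_pressure hr.1, ← exp_pressure hr.1, ← exp_pressure hr.1, ← Real.exp_add,
    ← Real.exp_add] at hmain
  rw [abs_lt] at h1 h2 h3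
  have e3 : δ ^ 2 / (2 * c) = 4 * (δ ^ 2 / (8 * c)) := by
    field_simp
    ring
  have e4 : δ ^ 2 / (4 * c) = 2 * (δ ^ 2 / (8 * c)) := by
    field_simp
    ring
  have e5 : δ * (δ / c) = 8 * (δ ^ 2 / (8 * c)) := by
    field_simp
  set ε := δ ^ 2 / (8 * c) with hεdef
  rw [e3] at hplus hminus
  set p := pressure d r μ with hp
  have b1 : δ * (α / r ^ d + 1) + pressure d r (μ - δ) / r ^ d ≤
      δ + (p / r ^ d + -(n / β * (δ ^ 2 / (4 * c)))) := by
    have h5 : δ * α + pressure d r (μ - δ) ≤ p - 2 * ε := by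
      have : δ * α = δ * q - 8 * ε := by
        rw [hα, mul_sub, e5]
      linarith [h1.1, h3.2]
    rw [← hV, e4]
    calc _ = δ + (δ * α + pressure d r (μ - δ)) / r ^ d := by ring
      _ ≤ δ + (p - 2 * ε) / r ^ d := by gcongr
      _ = _ := by ring
  have b2 : -(δ * n) + pressure d r (μ + δ) / r ^ d ≤
      p / r ^ d + -(n / β * (δ ^ 2 / (4 * c))) := by
    have h5 : -(δ * β) + pressure d r (μ + δ) ≤ p - 2 * ε := by
      have : δ * β = δ * q + 8 * ε := by
        rw [hβ, mul_add, e5]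
      linarith [h1.1, h2.2]
    rw [← hV, e4]
    calc _ = (-(δ * β) + pressure d r (μ + δ)) / r ^ d := by
          rw [← hnβ]
          field_simp
      _ ≤ (p - 2 * ε) / r ^ d := by gcongr
      _ = _ := by ring
  have hE : 0 < Real.exp (p / r ^ d) := Real.exp_pos _
  have hfin : Real.exp (p / r ^ d) ≤ Real.exp (p / r ^ d) *
      ((n * Real.exp δ + 1) * Real.exp (-(n / β * (δ ^ 2 / (4 * c))))) := by
    calc Real.exp (p / r ^ d) ≤ _ := hmain
      _ ≤ n * Real.exp (δ + (p / r ^ d + -(n / β * (δ ^ 2 / (4 * c))))) +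
          Real.exp (p / r ^ d + -(n / β * (δ ^ 2 / (4 * c)))) := by gcongr
      _ = _ := by
        rw [Real.exp_add δ, Real.exp_add (p / r ^ d)]
        ring
  have := mul_lt_mul_of_pos_left h4 hE
  linarith

/-- If the limiting pressure exceeds the parabola that would bound it for an ensemble in which
repulsion always increases the covered volume, then the insertion probability beats the one of
independent points at a suitable radius. -/
theorem eventually_insertion (hd : d ≠ 0) {c : ℝ} (hc : 0 < c)
    (hv : ∀ r, 0 < r → r < 1 / 2 → ballVolume d r = c * r ^ d) {μ₀ : ℕ}
    (hP : 1 + ((μ₀ : ℝ) ^ 2 / (2 * c) + 5 * μ₀) < limitPressure d μ₀) :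
    ∀ᶠ n : ℕ in atTop, ∃ r, 0 < r ∧
      (1 - ballVolume d r) ^ n * repulsionProb d n r < repulsionProb d (n + 1) r := by
  obtain ⟨K, hK0, hK⟩ := limitPressure_le_linear d
  -- At M ≥ 4cK the linear bound on the pressure has dropped below the parabola, which closes the
  -- interval to the right.
  obtain ⟨M, hM⟩ := exists_nat_ge (max (max (1 : ℝ) μ₀) (4 * c * K))
  -- The mesh δ = 1/D must satisfy 2δe^μ ≤ 1 for every μ ≤ M, and δ ≤ c.
  obtain ⟨D, hD⟩ := exists_nat_ge (max (max (1 : ℝ) (2 * Real.exp M)) (1 / c))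
  simp only [max_le_iff] at hM hD
  obtain ⟨⟨hM1, hMμ⟩, hMK⟩ := hM
  obtain ⟨⟨hD1, hDM⟩, hDc⟩ := hD
  have hD0 : (0 : ℝ) < D := by linarith
  set Q : ℝ → ℝ := fun x => x ^ 2 / (2 * c) + 5 * x with hQ
  set f : ℕ → ℝ := fun i => limitPressure d (i / D) - Q (i / D) with hf
  have hf0 : f 0 ≤ 1 := by
    simpa [hf, hQ] using limitPressure_zero_le d
  have hfa : 1 < f (μ₀ * D) := by
    simp only [hf, hQ]
    push_cast
    rw [mul_div_cancel_right₀ _ hD0.ne']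
    linarith
  have hfN : f (M * D) ≤ 0 := by
    simp only [hf, hQ]
    push_cast
    rw [mul_div_cancel_right₀ _ hD0.ne']
    have h1 := hK M (by linarith)
    have h2 : K * (1 + M) ≤ M ^ 2 / (2 * c) := by
      rw [le_div_iff₀ (by positivity)]
      have h3 : K * (1 + M) * (2 * c) ≤ K * (2 * M) * (2 * c) := by
        gcongr
        linarith
      have h4 : 4 * c * K * M ≤ M * M := by gcongr
      linarith
    have : (0 : ℝ) ≤ M := by linarith
    linarith
  obtain ⟨i, hiN, hi1, hi2⟩ := exists_interior_max (f := f) (a := μ₀ * D) (N := M * D)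
    (Nat.mul_le_mul_right _ (by exact_mod_cast hMμ)) (by linarith) (by linarith)
  set μ : ℝ := ((i + 1 : ℕ) : ℝ) / D with hμ
  set δ : ℝ := 1 / D with hδ
  have hδ0 : 0 < δ := by positivity
  have em : (i : ℝ) / D = μ - δ := by
    rw [hμ, hδ]
    push_cast
    ring
  have ep : ((i + 2 : ℕ) : ℝ) / D = μ + δ := by
    rw [hμ, hδ]
    push_cast
    ring
  have hμ0 : 0 ≤ μ := by positivity
  have hμM : μ ≤ M := by
    rw [hμ, div_le_iff₀ hD0]
    exact_mod_cast hiN.le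
  simp only [hf] at hi1 hi2
  rw [em, ← hμ] at hi1
  rw [ep, ← hμ] at hi2
  refine eventually_insertion_of_parabola hd hc hv hμ0 hδ0 ?_ ?_ ?_ ?_
  · rw [hδ]
    exact (one_div_le hD0 hc).2 hDc
  · rw [hδ, mul_one_div, div_mul_eq_mul_div, div_le_one hD0]
    exact le_trans (by gcongr) hDM
  · have : Q (μ + δ) - Q μ = δ * (μ / c + 5) + δ ^ 2 / (2 * c) := by
      simp only [hQ]
      field_simp
      ring
    linarith
  · have : Q (μ - δ) - Q μ = -(δ * (μ / c + 5)) + δ ^ 2 / (2 * c) := by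
      simp only [hQ]
      field_simp
      ring
    linarith

end MainArgument

/-! ### Volume of small balls -/

section BallVolume

/-- A ball of radius below 1/2 lies inside the fundamental domain centred at its centre, where the
flat distance is Euclidean. -/
theorem ballVolume_eq (d : ℕ) [NeZero d] {r : ℝ} (hr : 0 < r) (hr2 : r < 1 / 2) :
    ballVolume d r = Real.sqrt Real.pi ^ d / Real.Gamma (d / 2 + 1) * r ^ d := by
  have h1 : volume (torusBall (0 : UnitAddTorus (Fin d)) r) =
      volume (Metric.closedBall (0 : EuclideanSpace ℝ (Fin d)) r) := by
    rw [volume_torus_eq (-(1 / 2)) (measurableSet_torusBall _ _),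
      ← (PiLp.volume_preserving_toLp (Fin d)).measure_preimage
        measurableSet_closedBall.nullMeasurableSet]
    congr 1
    ext y
    simp only [torusBall, torusDist, Set.mem_ofPred_eq, Set.mem_preimage,
      Metric.mem_closedBall, dist_zero_right, EuclideanSpace.norm_eq, Pi.zero_apply, sub_zero,
      Real.norm_eq_abs]
    have hnorm : ∀ t : ℝ, |t| ≤ 1 / 2 → ‖(t : UnitAddCircle)‖ = |t| := fun t ht =>
      (AddCircle.norm_coe_eq_abs_iff 1 one_ne_zero).2 (by simpa using ht)
    constructor
    · rintro ⟨h1, h2⟩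
      convert h2 using 5 with i
      refine (hnorm _ (abs_le.2 ⟨(h1 i).1.le, ?_⟩)).symm
      linarith [(h1 i).2]
    · intro h
      have h1 : ∀ i, |y i| ≤ r := fun i => by
        refine le_trans (Real.le_sqrt_of_sq_le ?_) h
        exact Finset.single_le_sum (f := fun i => |y i| ^ 2) (fun i _ => sq_nonneg _)
          (Finset.mem_univ i)
      refine ⟨fun i => ?_, ?_⟩
      · have := abs_le.1 (h1 i)
        constructor <;> linarith
      · convert h using 5 with i
        exact hnorm _ ((h1 i).trans hr2.le)
  rw [ballVolume, measureReal_def, h1, EuclideanSpace.volume_closedBall, Fintype.card_fin,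
    ENNReal.toReal_mul, ENNReal.toReal_pow, ENNReal.toReal_ofReal hr.le,
    ENNReal.toReal_ofReal (by
      have : 0 < Real.Gamma ((d : ℝ) / 2 + 1) := Real.Gamma_pos_of_pos (by positivity)
      positivity), mul_comm]

end BallVolume

/-! ### A code-based lattice of minimal squared norm eight -/

section Code

/-- The parity checks of the extended Hamming code of length eight. -/
def hammingCheck (x : Fin 8 → ZMod 2) : Fin 4 → ZMod 2 :=
  ![x 0 + x 1 + x 2 + x 3 + x 4 + x 5 + x 6 + x 7, x 4 + x 5 + x 6 + x 7,
    x 2 + x 3 + x 6 + x 7, x 1 + x 3 + x 5 + x 7]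

theorem hammingCheck_add (x y : Fin 8 → ZMod 2) :
    hammingCheck (x + y) = hammingCheck x + hammingCheck y := by
  ext i
  fin_cases i <;> simp [hammingCheck] <;> ring

theorem hammingCheck_sub (x y : Fin 8 → ZMod 2) :
    hammingCheck (x - y) = hammingCheck x - hammingCheck y := by
  ext i
  fin_cases i <;> simp [hammingCheck] <;> ring

theorem four_le_card_of_hammingCheck (x : Fin 8 → ZMod 2) (h : hammingCheck x = 0)
    (hx : x ≠ 0) : 4 ≤ (Finset.univ.filter fun b => x b ≠ 0).card := by
  revert x
  decide +kernel

/-- Every odd entry contributes at least 1. -/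
theorem card_le_sum_sq {ι : Type*} [Fintype ι] (w : ι → ℤ) :
    ((Finset.univ.filter fun b => (w b : ZMod 2) ≠ 0).card : ℤ) ≤ ∑ b, w b ^ 2 := by
  rw [Finset.card_filter]
  push_cast
  refine Finset.sum_le_sum fun b _ => ?_
  split_ifs with h
  · have h0 : w b ≠ 0 := fun h0 => h (by simp [h0])
    have := Int.one_le_abs h0
    nlinarith [sq_abs (w b)]
  · positivity

/-- Modulo 2 the three blocks are Hamming codewords with sum zero, so if one is nonzero, at least
two are, and each has at least four odd entries. If all vanish, then w = 2y with Σy even; hence Σy²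
is even and positive, and 4Σy² ≥ 8. -/
theorem eight_le_sum_sq (w : Fin 3 × Fin 8 → ℤ) (hw : w ≠ 0)
    (h012 : (fun b => (w (0, b) : ZMod 2)) + (fun b => (w (1, b) : ZMod 2)) +
      (fun b => (w (2, b) : ZMod 2)) = 0)
    (h0 : hammingCheck (fun b => (w (0, b) : ZMod 2)) = 0)
    (h1 : hammingCheck (fun b => (w (1, b) : ZMod 2)) = 0)
    (h4 : (4 : ℤ) ∣ ∑ i, w i) : 8 ≤ ∑ i, w i ^ 2 := by
  set x : Fin 3 → Fin 8 → ZMod 2 := fun a b => (w (a, b) : ZMod 2) with hx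
  change x 0 + x 1 + x 2 = 0 at h012
  have hx2 : x 2 = x 0 + x 1 := by
    have h2 : x 2 = -(x 0 + x 1) := by
      rw [eq_neg_iff_add_eq_zero, add_comm]
      exact h012
    rw [h2]
    ext b
    exact ZMod.neg_eq_self_mod_two _
  have h2 : hammingCheck (x 2) = 0 := by
    rw [hx2, hammingCheck_add]
    change hammingCheck (x 0) = 0 at h0
    change hammingCheck (x 1) = 0 at h1
    rw [h0, h1, add_zero]
  have hblock : ∀ a, hammingCheck (x a) = 0 → x a ≠ 0 → 4 ≤ ∑ b, w (a, b) ^ 2 := fun a ha hxa => by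
    refine le_trans ?_ (card_le_sum_sq fun b => w (a, b))
    exact_mod_cast four_le_card_of_hammingCheck (x a) ha hxa
  have hpos : ∀ a, 0 ≤ ∑ b, w (a, b) ^ 2 := fun a => Finset.sum_nonneg fun b _ => sq_nonneg _
  have hsplit : ∑ i, w i ^ 2 = ∑ b, w (0, b) ^ 2 + ∑ b, w (1, b) ^ 2 + ∑ b, w (2, b) ^ 2 := by
    rw [Fintype.sum_prod_type, Fin.sum_univ_three]
  by_cases c0 : x 0 = 0
  · by_cases c1 : x 1 = 0
    · have c2 : x 2 = 0 := by rw [hx2, c0, c1, add_zero]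
      have hall : ∀ i, (2 : ℤ) ∣ w i := by
        rintro ⟨a, b⟩
        have hxa : x a = 0 := by
          fin_cases a
          exacts [c0, c1, c2]
        exact (ZMod.intCast_zmod_eq_zero_iff_dvd _ 2).1 (congrFun hxa b)
      choose y hy using hall
      have hs : ∑ i, w i = 2 * ∑ i, y i := by
        rw [Finset.mul_sum]
        exact Finset.sum_congr rfl fun i _ => hy i
      have hs2 : ∑ i, w i ^ 2 = 4 * ∑ i, y i ^ 2 := by
        rw [Finset.mul_sum]
        refine Finset.sum_congr rfl fun i _ => ?_
        rw [hy i]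
        ring
      have hpar : (2 : ℤ) ∣ ∑ i, y i ^ 2 - ∑ i, y i := by
        rw [← Finset.sum_sub_distrib]
        refine Finset.dvd_sum fun i _ => ?_
        have := (Int.even_mul_pred_self (y i)).two_dvd
        convert this using 1
        ring
      obtain ⟨i, hi⟩ := Function.ne_iff.1 hw
      have hyi : y i ≠ 0 := fun h => hi (by rw [hy i, h]; rfl)
      have h5 : 0 < ∑ i, y i ^ 2 := by
        refine Finset.sum_pos' (fun i _ => sq_nonneg _) ⟨i, Finset.mem_univ i, by positivity⟩
      omega
    · have c2 : x 2 ≠ 0 := by rwa [hx2, c0, zero_add]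
      have := hblock 1 h1 c1
      have := hblock 2 h2 c2
      have := hpos 0
      omega
  · by_cases c1 : x 1 = 0
    · have c2 : x 2 ≠ 0 := by rwa [hx2, c1, add_zero]
      have := hblock 0 h0 c0
      have := hblock 2 h2 c2
      have := hpos 1
      omega
    · have := hblock 0 h0 c0
      have := hblock 1 h1 c1
      have := hpos 2
      omega

/-- The syndrome of an integer vector with respect to a lattice in dimension `24` of minimal
squared norm eight. -/
def syndrome (w : Fin 3 × Fin 8 → ℤ) :
    (Fin 8 → ZMod 2) × (Fin 4 → ZMod 2) × (Fin 4 → ZMod 2) × ZMod 4 :=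
  ((fun b => (w (0, b) : ZMod 2)) + (fun b => (w (1, b) : ZMod 2)) +
      (fun b => (w (2, b) : ZMod 2)),
    hammingCheck (fun b => (w (0, b) : ZMod 2)), hammingCheck (fun b => (w (1, b) : ZMod 2)),
    ((∑ i, w i : ℤ) : ZMod 4))

/-- The syndrome depends only on residues modulo 4, so the difference may be replaced by its
shortest representative on a torus grid whose side is a multiple of 4. -/
theorem eight_le_sum_sq_of_syndrome_eq {u u' w : Fin 3 × Fin 8 → ℤ} (h : syndrome u = syndrome u')
    (hw : ∀ i, (4 : ℤ) ∣ u i - u' i - w i) (hw0 : w ≠ 0) : 8 ≤ ∑ i, w i ^ 2 := by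
  have e2 : ∀ i, (w i : ZMod 2) = (u i : ZMod 2) - (u' i : ZMod 2) := fun i => by
    have h1 : ((u i - u' i - w i : ℤ) : ZMod 2) = 0 :=
      (ZMod.intCast_zmod_eq_zero_iff_dvd _ 2).2 ((by norm_num : (2 : ℤ) ∣ 4).trans (hw i))
    push_cast at h1
    exact (sub_eq_zero.1 h1).symm
  have ef : ∀ a : Fin 3, (fun b => (w (a, b) : ZMod 2)) =
      (fun b => (u (a, b) : ZMod 2)) - fun b => (u' (a, b) : ZMod 2) := fun a =>
    funext fun b => e2 (a, b)
  simp only [syndrome, Prod.mk.injEq] at h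
  obtain ⟨g1, g2, g3, g4⟩ := h
  refine eight_le_sum_sq w hw0 ?_ ?_ ?_ ?_
  · rw [ef, ef, ef, sub_add_sub_comm, sub_add_sub_comm, g1, sub_self]
  · rw [ef, hammingCheck_sub, g2, sub_self]
  · rw [ef, hammingCheck_sub, g3, sub_self]
  · have h1 : (4 : ℤ) ∣ ∑ i, (u i - u' i - w i) := Finset.dvd_sum fun i _ => hw i
    rw [Finset.sum_sub_distrib, Finset.sum_sub_distrib] at h1
    have h2 := (ZMod.intCast_eq_intCast_iff_dvd_sub _ _ 4).1 g4
    push_cast at h2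
    omega

end Code

/-! ### Small cells around grid points -/

section Cells

variable {d : ℕ}

/-- The cube of side `s / L` at the grid point `u / L` of the torus. -/
def gridCell (L : ℕ) (s : ℝ) (u : Fin d → Fin L) : Set (UnitAddTorus (Fin d)) :=
  {x | ∀ i, torusRep x i ∈ Set.Ioc ((u i : ℝ) / L) (((u i : ℝ) + s) / L)}

theorem measurableSet_gridCell (L : ℕ) (s : ℝ) (u : Fin d → Fin L) :
    MeasurableSet (gridCell L s u) := by
  have h : gridCell L s u = ⋂ i, (fun x => torusRep x i) ⁻¹'
      Set.Ioc ((u i : ℝ) / L) (((u i : ℝ) + s) / L) := by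
    ext x
    rw [Set.mem_iInter]
    rfl
  rw [h]
  exact MeasurableSet.iInter fun i =>
    ((measurable_pi_apply i).comp measurable_torusRep) measurableSet_Ioc

theorem volume_gridCell {L : ℕ} (hL : 0 < L) {s : ℝ} (hs : 0 ≤ s) (hs1 : s ≤ 1)
    (u : Fin d → Fin L) : volume (gridCell L s u) = ENNReal.ofReal ((s / L) ^ d) := by
  have hL' : (0 : ℝ) < L := by exact_mod_cast hL
  rw [volume_torus_eq 0 (measurableSet_gridCell L s u)]
  have h : {y : Fin d → ℝ | (∀ i, y i ∈ Set.Ioc (0 : ℝ) (0 + 1)) ∧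
      (fun i => (y i : UnitAddCircle)) ∈ gridCell L s u} =
      Set.univ.pi fun i => Set.Ioc ((u i : ℝ) / L) (((u i : ℝ) + s) / L) := by
    ext y
    simp only [Set.mem_ofPred_eq, Set.mem_pi, Set.mem_univ, true_imp_iff]
    constructor
    · rintro ⟨h0, h1⟩ i
      have := h1 i
      rwa [torusRep_coe (by simpa using h0)] at this
    · intro h
      have h0 : ∀ i, y i ∈ Set.Ioc (0 : ℝ) 1 := fun i => by
        refine ⟨lt_of_le_of_lt (by positivity) (h i).1, (h i).2.trans ?_⟩
        rw [div_le_one hL']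
        have : ((u i : ℕ) : ℝ) + 1 ≤ L := by exact_mod_cast (u i).2
        linarith
      refine ⟨by simpa using h0, fun i => ?_⟩
      rw [torusRep_coe h0]
      exact h i
  rw [h, volume_pi_pi]
  simp only [Real.volume_Ioc]
  rw [Finset.prod_congr rfl (g := fun _ => ENNReal.ofReal (s / L)) fun i _ => by
    congr 1
    ring]
  rw [Finset.prod_const, Finset.card_univ, Fintype.card_fin, ENNReal.ofReal_pow (by positivity)]

theorem pow_card_le_torusPartition {L : ℕ} (hL : 0 < L) {s r z : ℝ} (hs : 0 ≤ s) (hs1 : s ≤ 1)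
    (hr : 0 ≤ r) (hz : 0 ≤ z) (C : Finset (Fin d → Fin L))
    (hC : ∀ u ∈ C, ∀ u' ∈ C, u ≠ u' → ∀ x ∈ gridCell L s u, ∀ y ∈ gridCell L s u',
      r < torusDist x y) :
    (1 + z * (s / L) ^ d) ^ C.card ≤ torusPartition d r z := by
  have := isFiniteMeasure_smul_volume (d := d) z
  have h0 : 0 ≤ torusPartition d r z := zero_le_one.trans (one_le_torusPartition d r hz)
  have hL' : (0 : ℝ) < L := by exact_mod_cast hL
  have hR : ∀ u v : C, u ≠ v → ∀ x ∈ gridCell L s u.1, ∀ y ∈ gridCell L s v.1,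
      r < torusDist x y := fun u v huv =>
    hC u.1 u.2 v.1 v.2 fun h => huv (Subtype.ext h)
  have h := prod_one_add_le_partitionFn
    (ENNReal.ofReal z • (volume : Measure (UnitAddTorus (Fin d))))
    (measurableSet_torusDist_gt d r) (Finset.univ : Finset C) (A := fun u => gridCell L s u.1)
    (fun u => measurableSet_gridCell L s u.1)
    (fun u v huv => Set.disjoint_left.2 fun x hx hx' => by
      have := hR u v huv x hx x hx'
      simp [torusDist] at this
      linarith) hR
  rw [← ENNReal.ofReal_le_ofReal_iff h0, ofReal_torusPartition r hz,
    ENNReal.ofReal_pow (by positivity)]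
  refine le_trans (le_of_eq ?_) (h.trans (partitionFn_mono _ _ (Set.subset_univ _)))
  simp only [Measure.smul_apply, volume_gridCell hL hs hs1, smul_eq_mul]
  rw [Finset.prod_const, Finset.card_univ, Fintype.card_coe, ENNReal.ofReal_add zero_le_one
    (by positivity), ENNReal.ofReal_one, ENNReal.ofReal_mul hz]

/-- Here `w` is the shortest representative of u - u' modulo L. If the points were within ρ/L, then
|w i| ≤ L‖x i - y i‖ + s; squaring, summing and applying Cauchy–Schwarz to the cross term
contradicts `hlt`. -/
theorem sq_lt_of_gridCell {L : ℕ} (hL : 0 < L) {s ρ : ℝ} (hs : 0 ≤ s) (hρ : 0 ≤ ρ)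
    {u u' : Fin d → Fin L} {w : Fin d → ℤ}
    (hw : w = fun i => (u i : ℤ) - (u' i : ℤ) - L * round (((u i : ℝ) - (u' i : ℝ)) / L))
    {x y : UnitAddTorus (Fin d)} (hx : x ∈ gridCell L s u) (hy : y ∈ gridCell L s u')
    (hlt : ρ ^ 2 + 2 * s * (Real.sqrt d * ρ) + d * s ^ 2 < ∑ i, (w i : ℝ) ^ 2) :
    ρ / L < torusDist x y := by
  have hL' : (0 : ℝ) < L := by exact_mod_cast hL
  by_contra hle
  rw [not_lt] at hle
  set p : Fin d → ℝ := fun i => L * ‖x i - y i‖ with hp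
  have hp0 : ∀ i, 0 ≤ p i := fun i => by positivity
  have hcoord : ∀ i, |(w i : ℝ)| ≤ p i + s := by
    intro i
    set t : ℝ := ((u i : ℝ) - (u' i : ℝ)) / L with ht
    set e : ℝ := torusRep x i - torusRep y i - t with he
    have h1 : |(w i : ℝ)| = L * ‖(t : UnitAddCircle)‖ := by
      rw [UnitAddCircle.norm_eq]
      conv_rhs => rw [← abs_of_pos hL']
      rw [← abs_mul, hw, ht]
      congr 1
      push_cast
      field_simp
    have h2 : (t : UnitAddCircle) = (x i - y i) - (e : UnitAddCircle) := by
      rw [← coe_torusRep x i, ← coe_torusRep y i, ← AddCircle.coe_sub, ← AddCircle.coe_sub, he]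
      congr 1
      ring
    have h3 : |e| ≤ s / L := by
      have hxi := hx i
      have hyi := hy i
      rw [add_div] at hxi hyi
      rw [he, ht, sub_div, abs_le]
      constructor <;> linarith [hxi.1, hxi.2, hyi.1, hyi.2]
    rw [h1, h2, hp]
    calc (L : ℝ) * ‖(x i - y i) - (e : UnitAddCircle)‖ ≤ L * (‖x i - y i‖ + s / L) := by
          gcongr
          exact (norm_sub_le _ _).trans
            (add_le_add_right ((UnitAddCircle.norm_coe_le e).trans h3) _)
      _ = _ := by field_simp
  have hsq : ∑ i, p i ^ 2 ≤ ρ ^ 2 := by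
    have h1 : ∑ i, p i ^ 2 = L ^ 2 * torusDist x y ^ 2 := by
      rw [torusDist, Real.sq_sqrt (Finset.sum_nonneg fun i _ => sq_nonneg _), Finset.mul_sum]
      exact Finset.sum_congr rfl fun i _ => by rw [hp, mul_pow]
    have h2 : L * torusDist x y ≤ ρ := by
      rw [le_div_iff₀ hL'] at hle
      linarith
    rw [h1, ← mul_pow]
    exact pow_le_pow_left₀ (mul_nonneg hL'.le (Real.sqrt_nonneg _)) h2 2
  have hsum : ∑ i, p i ≤ Real.sqrt d * ρ := by
    refine abs_le_of_sq_le_sq' ?_ (by positivity) |>.2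
    have := sq_sum_le_card_mul_sum_sq (s := (Finset.univ : Finset (Fin d))) (f := p)
    rw [Finset.card_univ, Fintype.card_fin] at this
    rw [mul_pow, Real.sq_sqrt (Nat.cast_nonneg d)]
    exact this.trans (by gcongr)
  have hfin : ∑ i, (w i : ℝ) ^ 2 ≤ ∑ i, (p i ^ 2 + 2 * s * p i + s ^ 2) :=
    Finset.sum_le_sum fun i _ => by
      rw [← sq_abs]
      calc |(w i : ℝ)| ^ 2 ≤ (p i + s) ^ 2 := pow_le_pow_left₀ (abs_nonneg _) (hcoord i) 2
        _ = _ := by ring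
  rw [Finset.sum_add_distrib, Finset.sum_add_distrib, ← Finset.mul_sum] at hfin
  simp only [Finset.sum_const, Finset.card_univ, Fintype.card_fin, nsmul_eq_mul] at hfin
  have := mul_le_mul_of_nonneg_left hsum (by positivity : 0 ≤ 2 * s)
  linarith

end Cells

/-! ### The dense packing in dimension 24 and the numerical comparison -/

section Dimension24

/-- Pigeonhole: the (4m)^24 = 2^48 m^24 grid points have only 2^(8+4+4+2) = 2^18 possible syndromes,
and distinct points with equal syndrome have squared distance at least 8 in grid units. -/
theorem exists_code {m : ℕ} (hm : 0 < m) : ∃ C : Finset (Fin 24 → Fin (4 * m)),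
    2 ^ 30 * m ^ 24 ≤ C.card ∧ ∀ u ∈ C, ∀ u' ∈ C, u ≠ u' →
      ∀ x ∈ gridCell (4 * m) (1 / 256) u, ∀ y ∈ gridCell (4 * m) (1 / 256) u',
        14 / 5 / (4 * m : ℕ) < torusDist x y := by
  classical
  let e : Fin 3 × Fin 8 ≃ Fin 24 := finProdFinEquiv
  let f : (Fin 24 → Fin (4 * m)) →
      (Fin 8 → ZMod 2) × (Fin 4 → ZMod 2) × (Fin 4 → ZMod 2) × ZMod 4 := fun u =>
    syndrome fun i => (u (e i) : ℤ)
  obtain ⟨g, hg⟩ := Fintype.exists_le_card_fiber_of_mul_le_card f (n := 2 ^ 30 * m ^ 24) (by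
    simp only [Fintype.card_prod, Fintype.card_pi, ZMod.card, Fintype.card_fin,
      Finset.prod_const, Finset.card_univ]
    rw [mul_pow]
    exact le_of_eq (by ring))
  refine ⟨_, hg, fun u hu u' hu' huu x hx y hy => ?_⟩
  have hL : 0 < 4 * m := by omega
  have hL' : (0 : ℝ) < (4 * m : ℕ) := by exact_mod_cast hL
  set w : Fin 24 → ℤ := fun i =>
    (u i : ℤ) - (u' i : ℤ) - (4 * m : ℕ) * round (((u i : ℝ) - (u' i : ℝ)) / (4 * m : ℕ)) with hw
  have hsyn : syndrome (fun i => (u (e i) : ℤ)) = syndrome (fun i => (u' (e i) : ℤ)) :=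
    (Finset.mem_filter.1 hu).2.trans (Finset.mem_filter.1 hu').2.symm
  have hw0 : (fun i => w (e i)) ≠ 0 := by
    intro h0
    refine huu (funext fun i => Fin.ext ?_)
    have h1 : w i = 0 := by simpa using congrFun h0 (e.symm i)
    have h2 : ((4 * m : ℕ) : ℤ) ∣ (u i : ℤ) - (u' i : ℤ) := ⟨_, sub_eq_zero.1 h1⟩
    have h3 := (u i).2
    have h4 := (u' i).2
    have h5 : (u i : ℤ) - (u' i : ℤ) = 0 :=
      Int.eq_zero_of_abs_lt_dvd h2 (by rw [abs_lt]; constructor <;> omega)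
    omega
  have h8 := eight_le_sum_sq_of_syndrome_eq hsyn (w := fun i => w (e i)) (fun i => by
    simp only [hw]
    rw [sub_sub_cancel]
    exact Dvd.dvd.mul_right ⟨(m : ℤ), by push_cast; rfl⟩ _) hw0
  rw [e.sum_comp fun i => w i ^ 2] at h8
  -- The separation 14/5 lies below √8 by enough to absorb cells of side 1/256: with √24 ≤ 5 the
  -- required sum is about 7.95 < 8.
  refine sq_lt_of_gridCell hL (by norm_num) (by norm_num) hw hx hy ?_
  have h9 : (8 : ℝ) ≤ ∑ i, (w i : ℝ) ^ 2 := by exact_mod_cast h8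
  have h10 : Real.sqrt (24 : ℕ) ≤ 5 := Real.sqrt_le_iff.2 (by norm_num)
  refine lt_of_lt_of_le ?_ h9
  push_cast at h10 ⊢
  linarith

/-- The slope is r^24 times the number 2^30 m^24 of cells; 3584/5 = 256 · 14/5 is the ratio of `r`
to the cell side, whose logarithm is the entropy cost of confining a centre to its cell. -/
theorem le_pressure_of_code {m : ℕ} (hm : 0 < m) (μ : ℝ) :
    (14 / 5) ^ 24 / 2 ^ 18 * (μ - 24 * Real.log (3584 / 5)) ≤
      pressure 24 (14 / 5 / (4 * m : ℕ)) μ := by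
  obtain ⟨C, hcard, hC⟩ := exists_code hm
  have hm' : (0 : ℝ) < m := by exact_mod_cast hm
  set r : ℝ := 14 / 5 / (4 * m : ℕ) with hr
  have hr0 : 0 < r := by positivity
  set z := Real.exp μ / r ^ 24 with hz
  have hz0 : 0 ≤ z := by positivity
  have h := pow_card_le_torusPartition (by omega : 0 < 4 * m) (by norm_num) (by norm_num) hr0.le
    hz0 C hC
  set q := z * (1 / 256 / (4 * m : ℕ)) ^ 24 with hq
  have hq0 : 0 < q := by positivity
  have hqe : Real.log q = μ - 24 * Real.log (3584 / 5) := by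
    have h1 : q = Real.exp μ / (3584 / 5) ^ 24 := by
      rw [hq, hz, div_mul_eq_mul_div, mul_div_assoc, ← div_pow, hr]
      have : (1 / 256 / ((4 * m : ℕ) : ℝ)) / (14 / 5 / ((4 * m : ℕ) : ℝ)) = (3584 / 5)⁻¹ := by
        push_cast
        field_simp
        norm_num
      rw [this, inv_pow]
      exact (div_eq_mul_inv _ _).symm
    rw [h1, Real.log_div (by positivity) (by positivity), Real.log_exp, Real.log_pow]
    norm_num
  have h2 : (2 ^ 30 * m ^ 24 : ℕ) * Real.log (1 + q) ≤ Real.log (torusPartition 24 r z) := by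
    calc _ ≤ C.card * Real.log (1 + q) := by
          gcongr
          exact Real.log_nonneg (by linarith)
      _ = Real.log ((1 + q) ^ C.card) := (Real.log_pow _ _).symm
      _ ≤ _ := Real.log_le_log (by positivity) h
  have h3 : Real.log q ≤ Real.log (1 + q) := Real.log_le_log hq0 (by linarith)
  calc (14 / 5) ^ 24 / 2 ^ 18 * (μ - 24 * Real.log (3584 / 5))
      = r ^ 24 * ((2 ^ 30 * m ^ 24 : ℕ) * Real.log q) := by
        rw [hqe, hr, div_pow, ← mul_assoc]
        congr 1
        push_cast
        field_simp
        norm_num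
    _ ≤ r ^ 24 * Real.log (torusPartition 24 r z) := by
        gcongr
        exact le_trans (by gcongr) h2
    _ = _ := rfl

theorem le_limitPressure (μ : ℝ) :
    (14 / 5) ^ 24 / 2 ^ 18 * (μ - 24 * Real.log (3584 / 5)) ≤ limitPressure 24 μ := by
  have h1 : Tendsto (fun m : ℕ => (14 / 5 : ℝ) / (4 * m : ℕ)) atTop (𝓝[>] 0) := by
    refine tendsto_nhdsWithin_iff.2 ⟨?_, ?_⟩
    · refine tendsto_const_nhds.div_atTop (tendsto_natCast_atTop_atTop.comp ?_)
      exact tendsto_id.const_mul_atTop' (by norm_num)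
    · filter_upwards [eventually_gt_atTop 0] with m hm
      have : (0 : ℝ) < m := by exact_mod_cast hm
      exact Set.mem_Ioi.2 (by positivity)
  refine ge_of_tendsto ((tendsto_pressure 24 μ).comp h1) ?_
  filter_upwards [eventually_gt_atTop 0] with m hm
  exact le_pressure_of_code hm μ

/-- The value 316 is about twice L = 24 log(3584/5), where the line S(μ - L) clears the parabola as
soon as cS > 2L. The two sides are about 3.2·10^7 and 2.6·10^7. -/
theorem parabola_lt_limitPressure :
    1 + (((316 : ℕ) : ℝ) ^ 2 / (2 * (Real.sqrt Real.pi ^ 24 / Real.Gamma ((24 : ℕ) / 2 + 1))) +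
      5 * (316 : ℕ)) < limitPressure 24 (316 : ℕ) := by
  refine lt_of_lt_of_le ?_ (le_limitPressure _)
  have hG : Real.Gamma ((24 : ℕ) / 2 + 1) = 479001600 := by
    have := Real.Gamma_nat_eq_factorial 12
    norm_num [Nat.factorial] at this ⊢
  have hpi : (3.14 : ℝ) ^ 12 ≤ Real.sqrt Real.pi ^ 24 := by
    rw [show (24 : ℕ) = 2 * 12 by norm_num, pow_mul, Real.sq_sqrt Real.pi_pos.le]
    exact pow_le_pow_left₀ (by norm_num) Real.pi_gt_d2.le 12
  have hlog : 24 * Real.log (3584 / 5) ≤ 158.1 := by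
    have h1 : Real.log ((3584 / 5) ^ 24) ≤ Real.log (2 ^ 228) :=
      Real.log_le_log (by positivity) (by norm_num)
    rw [Real.log_pow, Real.log_pow] at h1
    have := Real.log_two_lt_d9
    push_cast at h1
    linarith
  rw [hG]
  have h2 : ((316 : ℕ) : ℝ) ^ 2 / (2 * (Real.sqrt Real.pi ^ 24 / 479001600)) ≤
      316 ^ 2 / (2 * (3.14 ^ 12 / 479001600)) := by
    push_cast
    gcongr
  have h3 : (14 / 5 : ℝ) ^ 24 / 2 ^ 18 * (316 - 158.1) ≤
      (14 / 5) ^ 24 / 2 ^ 18 * (((316 : ℕ) : ℝ) - 24 * Real.log (3584 / 5)) := by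
    push_cast
    gcongr
  refine lt_of_lt_of_le ?_ h3
  refine lt_of_le_of_lt (b := 1 + ((316 : ℝ) ^ 2 / (2 * (3.14 ^ 12 / 479001600)) + 5 * 316)) ?_ ?_
  · push_cast at h2 ⊢
    linarith
  · norm_num

end Dimension24
end

theorem mainTheorem3 :
    ∀ᶠ n : ℕ in atTop, ∃ r : ℝ, 0 < r ∧
      0 < uniformCenters 24 n (repulsionEvent 24 n r) ∧
      ∫ x, unionVolume r x
          ∂(ProbabilityTheory.cond (uniformCenters 24 n) (repulsionEvent 24 n r)) <
        ∫ x, unionVolume r x ∂(uniformCenters 24 n) := by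
  have hc : 0 < Real.sqrt Real.pi ^ 24 / Real.Gamma ((24 : ℕ) / 2 + 1) :=
    div_pos (pow_pos (Real.sqrt_pos.2 Real.pi_pos) _) (Real.Gamma_pos_of_pos (by positivity))
  filter_upwards [eventually_insertion (by norm_num) hc
    (fun r hr hr2 => ballVolume_eq 24 hr hr2) parabola_lt_limitPressure] with n hn
  obtain ⟨r, hr, h⟩ := hn
  have h1 : 0 ≤ (1 - ballVolume 24 r) ^ n * repulsionProb 24 n r :=
    mul_nonneg (pow_nonneg (by linarith [ballVolume_le_one 24 r]) n) (repulsionProb_nonneg _ _ _)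
  exact ⟨r, hr, integral_cond_unionVolume_lt h (repulsionProb_pos_of_succ (h1.trans_lt h))⟩
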